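/- Let $a_0=1$ and $a_1,a_2,\dots\in\mathbb C$, let $X:\mathbb R\to\mathbb C$ be an arbitrary function, and for a momentum $k$ in $(1+d)$-dimensional Minkowski space write $X_k:=X(k^2)$ (for example $X_k=\sum_j\beta_j (k^2)^j$, the symbol of $\hat X=\sum_j\beta_j(-\partial_\mu\partial^\mu)^j$). A momentum $k$ is called onshell if $X_k=0$ and offshell otherwise. Apply the local diffeomorphism $\phi(\rho)=\sum_{j\ge 0}a_j\rho^{j+1}$ to the free Lagrangian $\mathcal L_\phi=\tfrac12\phi\hat X\phi$, which gives $\mathcal L_\rho=\tfrac12\sum_{j,l\ge0}a_ja_l\,\rho^{j+1}\hat X\rho^{l+1}$. The resulting Feynman rules are: the propagator $\frac{i}{X_k}$, and for each $n\ge3$ an $n$-valent vertex $$ i v_n=\frac i2\sum_{l=1}^{n-1}a_{n-l-1}a_{l-1}\sum_{\sigma\in S_n}X_{q_{\sigma(n-l+1)}+\dots+q_{\sigma(n)}} =\frac i2\sum_{l=1}^{n-1}a_{n-l-1}a_{l-1}(n-l)!\,l!\sum_{P\subseteq\{1,\dots,n\},\,|P|=l}X_{\sum_{j\in P}q_j},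 $$ where $q_1,\dots,q_n$ are the momenta entering the vertex. For $n>2$ let $A_n(k_1,\dots,k_n)$ be the sum of the Feynman amplitudes of all trees with $n$ labelled external edges carrying incoming momenta $k_1,\dots,k_n$ and with all vertices of valence at least $3$; the propagators of external edges are not included. Assume throughout that $k_1+\dots+k_n=0$ and that no internal propagator is singular, i.e. $X_{\sum_{i\in S}k_i}\ne0$ for every $S\subseteq\{1,\dots,n\}$ with $2\le|S|\le n-2$. Write $X_j:=X_{k_j}$. (1) For every $n>2$ there is a $C_n=C_n(a_1,a_2,\dots)$, depending only on $n$ and the $a_j$ (not on $d$, $X$ or the momenta), such that, whenever at most one of the $n$ external momenta is offshell, $$A_n(k_1,\dots,k_n)=-i\,C_n\cdot(X_1+\dots+X_n).$$ (2) Consequently the diffeomorphism does not change the tree-level $S$-matrix: if $n>2$ and all external momenta are onshell, then $A_n(k_1,\dots,k_n)=0$, which is also its value for the untransformed free field ($a_j=0$ for all $j\ge1$); and the quadratic part of $\mathcal L_\rho$, hence the propagator, is that of $\mathcal L_\phi$, i.e. the 2-valent function $v_2$, given by the same formula with $n=2$, satisfies $v_2(p,-p)=X_p$. -/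

import Mathlib

/-- Momentum space of a spacetime with one time and `d` space dimensions. -/
abbrev Momentum (d : ℕ) : Type := Fin (d + 1) → ℝ

/-- The Minkowski square `k_μ k^μ` of a momentum, signature `(+, -, …, -)`. -/
def minkowskiSq {d : ℕ} (k : Momentum d) : ℝ :=
  k 0 ^ 2 - ∑ j : Fin d, k j.succ ^ 2

/-- The offshell variable `X_k = X (k²)`: the action in momentum space of the kinetic operator of
the free Lagrangian `½ φ X̂ φ`. A differential operator `X̂ = ∑ β_j (-∂_μ ∂^μ)^j` corresponds to
`X s = ∑ β_j s ^ j`. The momentum `k` is onshell iff this is zero. -/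
def offshellVar {d : ℕ} (X : ℝ → ℂ) (k : Momentum d) : ℂ := X (minkowskiSq k)

/-- Coefficient of `ρ ^ p` in the local diffeomorphism `φ(ρ) = ∑_{j ≥ 0} a_j ρ ^ (j + 1)`. -/
def diffeoCoeff (a : ℕ → ℂ) : ℕ → ℂ
  | 0 => 0
  | j + 1 => a j

/-- Coefficients of the trivial diffeomorphism `φ(ρ) = ρ`. -/
def trivialDiffeo : ℕ → ℂ := fun j => if j = 0 then 1 else 0

/-- The vertex function `v` of the transformed Lagrangian
`L_ρ = ½ φ(ρ) X̂ φ(ρ) = ∑_{p, r} ½ φ_p φ_r ρ ^ p X̂ ρ ^ r`, for incoming edges indexed by `ι` with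
momenta `q`. Every monomial with `p + r` equal to the valence contributes once for each
assignment `σ` of the edges to its field factors; the `r` factors on which `X̂` acts are
those in the last positions. -/
noncomputable def vertexFunction {d : ℕ} {ι : Type*} [Fintype ι] [DecidableEq ι]
    (a : ℕ → ℂ) (X : ℝ → ℂ) (q : ι → Momentum d) : ℂ :=
  ∑ p ∈ Finset.range (Fintype.card ι + 1),
    (1 / 2 : ℂ) * diffeoCoeff a p * diffeoCoeff a (Fintype.card ι - p) *
      ∑ σ : Fin (Fintype.card ι) ≃ ι,
        offshellVar X (∑ s : Fin (Fintype.card ι) with p ≤ s.val, q (σ s))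

/-- The propagator `i / X_k`. -/
noncomputable def propagator {d : ℕ} (X : ℝ → ℂ) (k : Momentum d) : ℂ :=
  Complex.I / offshellVar X k

/-- `G` is a tree whose external edges are labelled by `L` and whose (interaction) vertices are
labelled by `M`. The external edge `i` is the unique edge at the leaf `Sum.inl i`; the vertices
`Sum.inr v` have valence at least three. -/
def IsFeynmanTree {L M : Type*} (G : SimpleGraph (L ⊕ M)) : Prop :=
  G.IsTree ∧ (∀ i : L, (G.neighborSet (Sum.inl i)).ncard = 1) ∧
    ∀ v : M, 3 ≤ (G.neighborSet (Sum.inr v)).ncard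

open Classical in
/-- The momentum flowing from `v` to `u` through the edge `uv` of a tree, where the external
edges carry the incoming momenta `k`: by momentum conservation it is the sum of all external
momenta that enter on the `v`-side of the edge. -/
noncomputable def edgeMomentum {d : ℕ} {L M : Type*} [Fintype L] (G : SimpleGraph (L ⊕ M))
    (k : L → Momentum d) (u v : L ⊕ M) : Momentum d :=
  ∑ i : L with (G.deleteEdges {s(u, v)}).Reachable v (Sum.inl i), k i

open Classical in
/-- The Feynman amplitude of a tree: a factor `i v` for each vertex and a propagator for each
internal edge (an edge joining two vertices). Propagators of external edges are not included. -/
noncomputable def treeAmplitude {d m : ℕ} {L : Type*} [Fintype L] (a : ℕ → ℂ) (X : ℝ → ℂ)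
    (k : L → Momentum d) (G : SimpleGraph (L ⊕ Fin m)) : ℂ :=
  (∏ v : Fin m, Complex.I *
      vertexFunction a X
        (fun u : G.neighborSet (Sum.inr v) => edgeMomentum G k (Sum.inr v) u)) *
    ∏ e : Fin m × Fin m with e.1 < e.2 ∧ G.Adj (Sum.inr e.1) (Sum.inr e.2),
      propagator X (edgeMomentum G k (Sum.inr e.1) (Sum.inr e.2))

open Classical in
/-- The amputated tree sum with `n` external edges: the sum over all trees, up to
renaming of their vertices. Trees with `m` labelled vertices are summed with weight `1 / m!`;
as all vertices have valence at least three, no nontrivial renaming of the vertices fixes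
such a tree and all its external edges, so every tree is counted exactly once, and there are
fewer than `n` vertices. -/
noncomputable def treeSum {d n : ℕ} (a : ℕ → ℂ) (X : ℝ → ℂ) (k : Fin n → Momentum d) : ℂ :=
  ∑ m ∈ Finset.range n, (1 / (m.factorial : ℂ)) *
    ∑ G : SimpleGraph (Fin n ⊕ Fin m) with IsFeynmanTree G, treeAmplitude a X k G

/-- The kinematics `k` conserves the total momentum, and no internal edge of a tree is onshell
(so that all internal propagators are finite). The internal edges are the splits of the external
edges into two parts with at least two elements each. -/
def AdmissibleKinematics {d n : ℕ} (X : ℝ → ℂ) (k : Fin n → Momentum d) : Prop :=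
  ∑ i, k i = 0 ∧
    ∀ S : Finset (Fin n), 2 ≤ S.card → 2 ≤ Sᶜ.card → offshellVar X (∑ i ∈ S, k i) ≠ 0

open Finset

set_option linter.unusedSectionVars false

/-! Take as root an external edge `r` such that all other external edges are onshell. Each node of a
Feynman tree other than the root has a set of external edges below it. Since vertices have valence
at least three, distinct nodes have distinct sets, so a tree amounts to a laminar family on the
complement of `r` (a hierarchy) with one nontrivial member for each vertex. A hierarchy with `m`
nontrivial members has `m!` labellings, which the weight `1 / m!` removes: this is
`treeSum_eq_hierarchySum`. Splitting a hierarchy at its top (`hierarchySum_eq_sum_setPartitions`)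
turns the tree sum into a recursion over set partitions.

Let `c j` be `j!` times the coefficient of `ρ ^ j` in `φ`, and let `b S` (`inverseCoeff`) be the
coefficient in degree `#S` of the compositional inverse of `φ`, normalised in the same way. The
claim is that all subtrees with leaf set `S`, including the propagator above them, sum to `b S`. By
induction the branches at the top vertex contribute factors `b B`. The vertex is itself a sum over
sets `Q` of branches whose total momentum enters `X`. Summed over all partitions of `S`, the choice
of `Q` becomes the choice of its union `T`, and the sum over partitions of `T` splits off as `X_T`
times the coefficient of `φ ∘ φ⁻¹` at `T`. That coefficient vanishes if `T` has at least two
elements; if `T` is a single leaf then `X_T = 0`, and if `T` is empty then `c 0 = 0`. Hence the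
total is zero (`sum_vertexWeight_eq_zero`).

The one-block partition is no vertex of a tree; its term is `X_S * b S`, so the genuine vertices sum
to `-X_S * b S`. The factor `i` of the vertex and the propagator `i / X_S` turn this into `b S`. At
the root the propagator is absent and `-i * b S * X_r` remains (`hierarchySum_vertexWeight`,
`treeSum_eq`). Thus `C_n` is `b` on a set of `n - 1` elements, and `X_r` is the sum of all `X_j`. -/

/-! ### Vertex functions as sums over subsets of edges. -/

/-- The coefficient of `ρ ^ j / j!` in the diffeomorphism. -/
noncomputable def symWeight (a : ℕ → ℂ) (j : ℕ) : ℂ := (j.factorial : ℂ) * diffeoCoeff a j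

@[simp] lemma symWeight_zero (a : ℕ → ℂ) : symWeight a 0 = 0 := by
  simp [symWeight, diffeoCoeff]

lemma symWeight_one (a : ℕ → ℂ) : symWeight a 1 = a 0 := by
  simp [symWeight, diffeoCoeff]

lemma offshellVar_neg {d : ℕ} (X : ℝ → ℂ) (k : Momentum d) :
    offshellVar X (-k) = offshellVar X k := by
  simp [offshellVar, minkowskiSq]

/-- Summing a function of the first `p` elements over all enumerations of `ι`. -/
lemma sum_equiv_initial {ι : Type*} [Fintype ι] [DecidableEq ι] (g : Finset ι → ℂ) {p : ℕ}
    (hp : p ≤ Fintype.card ι) :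
    ∑ σ : Fin (Fintype.card ι) ≃ ι, g (univ.filter fun x => (σ.symm x).val < p) =
      ∑ P ∈ powersetCard p (univ : Finset ι),
        ((p.factorial * (Fintype.card ι - p).factorial : ℕ) : ℂ) * g P := by
  have hcard : ∀ f : Numbering ι, #(univ.filter fun x => (f x).val < p) = p := by
    intro f
    have : (univ.filter fun x => (f x).val < p) =
        (univ.filter fun s : Fin (Fintype.card ι) => s.val < p).map f.symm.toEmbedding := by
      ext x
      simp only [mem_filter, mem_univ, true_and, mem_map_equiv, Equiv.symm_symm]
    rw [this, card_map, Fin.card_filter_val_lt, min_eq_right hp]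
  -- Inverse enumerations are the numberings of `ι`. They are grouped by the set `P` numbered first;
  -- each such set has `p! (card ι - p)!` numberings.
  refine (Fintype.sum_equiv (Equiv.symmEquiv _ _) _
    (fun f : Numbering ι => g (univ.filter fun x => (f x).val < p)) (fun σ => rfl)).trans ?_
  rw [← sum_fiberwise_of_maps_to (s := univ) (t := powersetCard p (univ : Finset ι))
    (g := fun f : Numbering ι => univ.filter fun x => (f x).val < p)
    (fun f _ => mem_powersetCard.2 ⟨subset_univ _, hcard f⟩)]
  refine sum_congr rfl fun P hP => ?_
  have hP' := (mem_powersetCard.1 hP).2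
  have : (univ.filter fun f : Numbering ι => (univ.filter fun x => (f x).val < p) = P) =
      Numbering.prefixed P := by
    ext f
    simp only [mem_filter, mem_univ, true_and, Numbering.mem_prefixed, Numbering.IsPrefix, hP',
      Finset.ext_iff]
    exact forall_congr' fun x => Iff.comm
  rw [sum_congr rfl (fun f hf => by rw [(mem_filter.1 hf).2]), sum_const, this,
    Numbering.card_prefixed, hP', nsmul_eq_mul]

/-- The vertex function as a sum over subsets of the edges. -/
lemma vertexFunction_eq_sum_finset {d : ℕ} {ι : Type*} [Fintype ι] [DecidableEq ι]
    (a : ℕ → ℂ) (X : ℝ → ℂ) (q : ι → Momentum d) :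
    vertexFunction a X q = (1 / 2 : ℂ) * ∑ P : Finset ι,
      symWeight a #P * symWeight a (Fintype.card ι - #P) * offshellVar X (∑ i ∈ Pᶜ, q i) := by
  rw [← powerset_univ, sum_powerset, mul_sum, vertexFunction, card_univ]
  refine sum_congr rfl fun p hp => ?_
  have hp' : p ≤ Fintype.card ι := Nat.lt_succ_iff.1 (mem_range.1 hp)
  have h1 : ∀ σ : Fin (Fintype.card ι) ≃ ι,
      offshellVar X (∑ s : Fin (Fintype.card ι) with p ≤ s.val, q (σ s)) =
      (fun P : Finset ι => offshellVar X (∑ i ∈ Pᶜ, q i))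
        (univ.filter fun x => (σ.symm x).val < p) := by
    intro σ
    refine congrArg _ (sum_equiv σ (fun s => ?_) fun s _ => rfl)
    simp
  rw [sum_congr rfl (fun σ _ => h1 σ), sum_equiv_initial (fun P : Finset ι => offshellVar X (∑ i ∈ Pᶜ, q i)) hp', mul_sum, mul_sum]
  refine sum_congr rfl fun P hP => ?_
  rw [(mem_powersetCard.1 hP).2]
  simp only [symWeight]
  push_cast
  ring

/-- The vertex function with conserved momenta, as a sum over subsets that avoid a given edge. -/
lemma vertexFunction_eq_sum_powerset {d : ℕ} {ι : Type*} [Fintype ι] [DecidableEq ι]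
    (a : ℕ → ℂ) (X : ℝ → ℂ) (q : ι → Momentum d) (r : ι) (hq : ∑ i, q i = 0) :
    vertexFunction a X q = ∑ P ∈ (univ.erase r).powerset,
      symWeight a #P * symWeight a (Fintype.card ι - #P) * offshellVar X (∑ i ∈ P, q i) := by
  have hX : ∀ P : Finset ι, offshellVar X (∑ i ∈ Pᶜ, q i) = offshellVar X (∑ i ∈ P, q i) := by
    intro P
    rw [← offshellVar_neg X (∑ i ∈ P, q i), eq_neg_of_add_eq_zero_left
      ((sum_compl_add_sum P q).trans hq)]
  rw [vertexFunction_eq_sum_finset]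
  simp only [hX]
  set f : Finset ι → ℂ := fun P =>
    symWeight a #P * symWeight a (Fintype.card ι - #P) * offshellVar X (∑ i ∈ P, q i) with hf
  have hfc : ∀ P, f Pᶜ = f P := by
    intro P
    have := card_le_univ P
    simp only [hf, hX, card_compl]
    rw [Nat.sub_sub_self this]
    ring
  have hr : (univ.erase r).powerset = univ.filter fun P : Finset ι => r ∉ P := by
    ext P
    simp [subset_erase]
  -- Complementation preserves each term and exchanges the sets containing `r` with those avoiding
  -- it, which absorbs the factor `1 / 2`.
  have hcompl : ∑ P : Finset ι with ¬ r ∉ P, f P = ∑ P : Finset ι with r ∉ P, f P :=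
    sum_nbij' compl compl (by simp) (by simp) (by simp) (by simp) (fun P _ => (hfc P).symm)
  rw [hr, ← sum_filter_add_sum_filter_not univ (fun P : Finset ι => r ∉ P) f, hcompl]
  ring

/-- Since `symWeight a 0 = 0`, the empty subset drops out and only `{0}` contributes. -/
lemma vertexFunction_pair {d : ℕ} (a : ℕ → ℂ) (ha : a 0 = 1) (X : ℝ → ℂ) (p : Momentum d) :
    vertexFunction a X ![p, -p] = offshellVar X p := by
  have h : (univ.erase (1 : Fin 2)).powerset = {∅, {0}} := by decide
  rw [vertexFunction_eq_sum_powerset a X _ 1 (by simp), h, sum_pair (by decide)]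
  simp [symWeight_one, ha]

/-! ### Hierarchies and their decomposition at the top. -/

/-- A hierarchy on `S`: a laminar family of nonempty subsets of `S` that contains `S` and all
singletons. -/
structure IsHierarchy {α : Type*} (S : Finset α) (F : Finset (Finset α)) : Prop where
  top_mem : S ∈ F
  subset : ∀ A ∈ F, A ⊆ S
  nonempty : ∀ A ∈ F, A.Nonempty
  singleton_mem : ∀ i ∈ S, {i} ∈ F
  laminar : ∀ A ∈ F, ∀ B ∈ F, A ⊆ B ∨ B ⊆ A ∨ Disjoint A B

/-- A partition of the finite set `S` into nonempty blocks. -/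
structure IsSetPartition {α : Type*} (S : Finset α) (π : Finset (Finset α)) : Prop where
  nonempty : ∀ B ∈ π, B.Nonempty
  disjoint : ∀ B ∈ π, ∀ C ∈ π, B ≠ C → Disjoint B C
  subset : ∀ B ∈ π, B ⊆ S
  cover : ∀ i ∈ S, ∃ B ∈ π, i ∈ B

open Classical in
/-- The finite set of all hierarchies on `S`. -/
noncomputable def hierarchies {α : Type*} (S : Finset α) : Finset (Finset (Finset α)) :=
  S.powerset.powerset.filter (IsHierarchy S)

open Classical in
/-- The finite set of all partitions of `S`. -/
noncomputable def setPartitions {α : Type*} (S : Finset α) : Finset (Finset (Finset α)) :=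
  S.powerset.powerset.filter (IsSetPartition S)

lemma mem_hierarchies {α : Type*} {S : Finset α} {F : Finset (Finset α)} :
    F ∈ hierarchies S ↔ IsHierarchy S F := by
  simp only [hierarchies, mem_filter, mem_powerset, and_iff_right_iff_imp]
  exact fun h A hA => mem_powerset.2 (h.subset A hA)

lemma mem_setPartitions {α : Type*} {S : Finset α} {π : Finset (Finset α)} :
    π ∈ setPartitions S ↔ IsSetPartition S π := by
  simp only [setPartitions, mem_filter, mem_powerset, and_iff_right_iff_imp]
  exact fun h A hA => mem_powerset.2 (h.subset A hA)

section

variable {α : Type*} [DecidableEq α]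

/-- The maximal members of `F` strictly below `A`. -/
def childrenOf (F : Finset (Finset α)) (A : Finset α) : Finset (Finset α) :=
  F.filter fun B => B ⊂ A ∧ ∀ C ∈ F, B ⊂ C → ¬ C ⊂ A

lemma mem_childrenOf {F : Finset (Finset α)} {A B : Finset α} :
    B ∈ childrenOf F A ↔ B ∈ F ∧ B ⊂ A ∧ ∀ C ∈ F, B ⊂ C → ¬ C ⊂ A := by
  simp [childrenOf]

/-- The sum over all hierarchies on `S` of the product of the weights `w A π` of their
nontrivial members `A` with children `π`. -/
noncomputable def hierarchySum (w : Finset α → Finset (Finset α) → ℂ) (S : Finset α) : ℂ :=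
  ∑ F ∈ hierarchies S, ∏ A ∈ F with 2 ≤ #A, w A (childrenOf F A)

lemma exists_childrenOf_superset {F : Finset (Finset α)} {A B : Finset α} (hB : B ∈ F)
    (hBA : B ⊂ A) : ∃ C ∈ childrenOf F A, B ⊆ C := by
  obtain ⟨C, hBC, hC⟩ := (F.filter fun C => C ⊂ A).exists_le_maximal (mem_filter.2 ⟨hB, hBA⟩)
  have hC' := mem_filter.1 hC.prop
  refine ⟨C, mem_childrenOf.2 ⟨hC'.1, hC'.2, fun D hD hCD hDA => ?_⟩, hBC⟩
  exact hCD.2 (hC.2 (mem_filter.2 ⟨hD, hDA⟩) hCD.1)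

namespace IsHierarchy

variable {S : Finset α} {F : Finset (Finset α)}

/-- Laminarity leaves only nesting as an alternative to disjointness, and maximality excludes
nesting of two children. The singletons in `F` make the children cover `A`; they lie strictly below
`A` because `2 ≤ #A`. -/
lemma isSetPartition_childrenOf (h : IsHierarchy S F) {A : Finset α} (hA : A ∈ F)
    (hcard : 2 ≤ #A) : IsSetPartition A (childrenOf F A) where
  nonempty B hB := h.nonempty B (mem_childrenOf.1 hB).1
  disjoint B hB C hC hne := by
    obtain ⟨hBF, hBA, hB⟩ := mem_childrenOf.1 hB
    obtain ⟨hCF, hCA, hC⟩ := mem_childrenOf.1 hC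
    rcases h.laminar B hBF C hCF with hBC | hCB | hd
    · exact absurd hCA (hB C hCF (hBC.ssubset_of_ne hne))
    · exact absurd hBA (hC B hBF (hCB.ssubset_of_ne hne.symm))
    · exact hd
  subset B hB := (mem_childrenOf.1 hB).2.1.1
  cover i hi := by
    have hss : {i} ⊂ A := (singleton_subset_iff.2 hi).ssubset_of_ne
      (fun he => by rw [← he] at hcard; simp at hcard)
    obtain ⟨C, hC, hiC⟩ := exists_childrenOf_superset
      (h.singleton_mem i (h.subset A hA hi)) hss
    exact ⟨C, hC, singleton_subset_iff.1 hiC⟩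

lemma restrict (h : IsHierarchy S F) {B : Finset α} (hB : B ∈ F) :
    IsHierarchy B (F.filter (· ⊆ B)) where
  top_mem := mem_filter.2 ⟨hB, Subset.rfl⟩
  subset _ hA := (mem_filter.1 hA).2
  nonempty A hA := h.nonempty A (mem_filter.1 hA).1
  singleton_mem i hi := mem_filter.2
    ⟨h.singleton_mem i (h.subset B hB hi), singleton_subset_iff.2 hi⟩
  laminar A hA C hC := h.laminar A (mem_filter.1 hA).1 C (mem_filter.1 hC).1

end IsHierarchy

lemma childrenOf_filter_subset {F : Finset (Finset α)} {A B : Finset α} (hAB : A ⊆ B) :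
    childrenOf (F.filter (· ⊆ B)) A = childrenOf F A := by
  ext C
  simp only [mem_childrenOf, mem_filter]
  constructor
  · rintro ⟨⟨hC, -⟩, hCA, h⟩
    exact ⟨hC, hCA, fun D hD hCD hDA => h D ⟨hD, hDA.1.trans hAB⟩ hCD hDA⟩
  · rintro ⟨hC, hCA, h⟩
    exact ⟨⟨hC, hCA.1.trans hAB⟩, hCA, fun D hD => h D hD.1⟩

lemma not_mem_childrenOf_self {F : Finset (Finset α)} {A : Finset α} : A ∉ childrenOf F A :=
  fun h => (mem_childrenOf.1 h).2.1.ne rfl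

/-- Glue hierarchies on the blocks of a partition of `S`. -/
def glueHierarchy (S : Finset α) (π : Finset (Finset α))
    (f : ∀ B ∈ π, Finset (Finset α)) : Finset (Finset α) :=
  insert S (π.attach.biUnion fun B => f B.1 B.2)

lemma mem_glueHierarchy {S : Finset α} {π : Finset (Finset α)}
    {f : ∀ B ∈ π, Finset (Finset α)} {A : Finset α} :
    A ∈ glueHierarchy S π f ↔ A = S ∨ ∃ B, ∃ hB : B ∈ π, A ∈ f B hB := by
  simp [glueHierarchy]

section Glue

variable {S : Finset α} {π : Finset (Finset α)} {f : ∀ B ∈ π, Finset (Finset α)}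

lemma isHierarchy_glueHierarchy (hS : S.Nonempty) (hπ : IsSetPartition S π)
    (hf : ∀ B hB, IsHierarchy B (f B hB)) : IsHierarchy S (glueHierarchy S π f) where
  top_mem := mem_glueHierarchy.2 (Or.inl rfl)
  subset A hA := by
    obtain rfl | ⟨B, hB, hA⟩ := mem_glueHierarchy.1 hA
    · exact Subset.rfl
    · exact ((hf B hB).subset A hA).trans (hπ.subset B hB)
  nonempty A hA := by
    obtain rfl | ⟨B, hB, hA⟩ := mem_glueHierarchy.1 hA
    · exact hS
    · exact (hf B hB).nonempty A hA
  singleton_mem i hi := by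
    obtain ⟨B, hB, hiB⟩ := hπ.cover i hi
    exact mem_glueHierarchy.2 (Or.inr ⟨B, hB, (hf B hB).singleton_mem i hiB⟩)
  laminar A hA A' hA' := by
    obtain hAS | ⟨B, hB, hAB⟩ := mem_glueHierarchy.1 hA
    · obtain hAS' | ⟨B', hB', hAB'⟩ := mem_glueHierarchy.1 hA'
      · exact Or.inl (hAS.trans hAS'.symm).subset
      · rw [hAS]
        exact Or.inr (Or.inl (((hf B' hB').subset A' hAB').trans (hπ.subset B' hB')))
    obtain hAS' | ⟨B', hB', hAB'⟩ := mem_glueHierarchy.1 hA'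
    · rw [hAS']
      exact Or.inl (((hf B hB).subset A hAB).trans (hπ.subset B hB))
    by_cases hBB : B = B'
    · subst hBB
      exact (hf B hB).laminar A hAB A' hAB'
    · exact Or.inr (Or.inr ((hπ.disjoint B hB B' hB' hBB).mono
        ((hf B hB).subset A hAB) ((hf B' hB').subset A' hAB')))

lemma filter_glueHierarchy (hπ : IsSetPartition S π) (hS : S ∉ π)
    (hf : ∀ B hB, IsHierarchy B (f B hB)) {B : Finset α} (hB : B ∈ π) :
    (glueHierarchy S π f).filter (· ⊆ B) = f B hB := by
  ext A
  simp only [mem_filter, mem_glueHierarchy]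
  constructor
  · rintro ⟨rfl | ⟨B', hB', hA⟩, hAB⟩
    · exact absurd ((hπ.subset B hB).antisymm hAB ▸ hB) hS
    · by_cases hBB : B' = B
      · subst hBB
        exact hA
      · obtain ⟨i, hi⟩ := (hf B' hB').nonempty A hA
        exact absurd (hAB hi)
          (disjoint_left.1 (hπ.disjoint B' hB' B hB hBB) ((hf B' hB').subset A hA hi))
  · exact fun hA => ⟨Or.inr ⟨B, hB, hA⟩, (hf B hB).subset A hA⟩

/-- With `S ∉ π` the inserted top is strictly larger than every block, so the blocks are its maximal
proper members. -/
lemma childrenOf_glueHierarchy (hπ : IsSetPartition S π) (hS : S ∉ π)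
    (hf : ∀ B hB, IsHierarchy B (f B hB)) : childrenOf (glueHierarchy S π f) S = π := by
  have hss : ∀ B ∈ π, B ⊂ S := fun B hB =>
    (hπ.subset B hB).ssubset_of_ne (fun h => hS (h ▸ hB))
  ext A
  simp only [mem_childrenOf, mem_glueHierarchy]
  constructor
  · rintro ⟨rfl | ⟨B, hB, hA⟩, hAS, h⟩
    · exact absurd rfl hAS.ne
    · by_contra hAπ
      exact h B (Or.inr ⟨B, hB, (hf B hB).top_mem⟩)
        (((hf B hB).subset A hA).ssubset_of_ne (fun h => hAπ (h ▸ hB))) (hss B hB)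
  · refine fun hA => ⟨Or.inr ⟨A, hA, (hf A hA).top_mem⟩, hss A hA, ?_⟩
    rintro C (rfl | ⟨B, hB, hC⟩) hAC hCS
    · exact hCS.ne rfl
    · by_cases hBA : B = A
      · subst hBA
        exact hAC.2 ((hf B hB).subset C hC)
      · obtain ⟨i, hi⟩ := hπ.nonempty A hA
        exact disjoint_left.1 (hπ.disjoint B hB A hA hBA) ((hf B hB).subset C hC (hAC.1 hi)) hi

end Glue

lemma IsHierarchy.glueHierarchy_restrict {S : Finset α} {F : Finset (Finset α)}
    (h : IsHierarchy S F) :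
    glueHierarchy S (childrenOf F S) (fun B _ => F.filter (· ⊆ B)) = F := by
  ext A
  simp only [mem_glueHierarchy, mem_filter, exists_prop]
  constructor
  · rintro (rfl | ⟨B, -, hA, -⟩)
    · exact h.top_mem
    · exact hA
  · intro hA
    by_cases hAS : A = S
    · exact Or.inl hAS
    · obtain ⟨C, hC, hAC⟩ := exists_childrenOf_superset hA ((h.subset A hA).ssubset_of_ne hAS)
      exact Or.inr ⟨C, hC, hA, hAC⟩

/-- Every member other than `S` lies below exactly one child of `S`. -/
lemma IsHierarchy.prod_eq_mul_prod_childrenOf {S : Finset α} {F : Finset (Finset α)}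
    (h : IsHierarchy S F) (hS : 2 ≤ #S) (g : Finset α → ℂ) :
    ∏ A ∈ F with 2 ≤ #A, g A =
      g S * ∏ B ∈ childrenOf F S, ∏ A ∈ F.filter (· ⊆ B) with 2 ≤ #A, g A := by
  rw [← prod_biUnion, ← prod_insert]
  · refine prod_congr ?_ fun _ _ => rfl
    ext A
    simp only [mem_filter, mem_insert, mem_biUnion]
    constructor
    · rintro ⟨hA, h2⟩
      by_cases hAS : A = S
      · exact Or.inl hAS
      · obtain ⟨C, hC, hAC⟩ :=
          exists_childrenOf_superset hA ((h.subset A hA).ssubset_of_ne hAS)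
        exact Or.inr ⟨C, hC, ⟨hA, hAC⟩, h2⟩
    · rintro (rfl | ⟨C, hC, ⟨hA, hAC⟩, h2⟩)
      · exact ⟨h.top_mem, hS⟩
      · exact ⟨hA, h2⟩
  · intro hmem
    obtain ⟨B, hB, hSB⟩ := mem_biUnion.1 hmem
    exact (mem_childrenOf.1 hB).2.1.2 (mem_filter.1 (mem_filter.1 hSB).1).2
  · intro B hB C hC hBC
    refine disjoint_left.2 fun A hA hA' => ?_
    have hAB := mem_filter.1 (mem_filter.1 hA).1
    have hAC := mem_filter.1 (mem_filter.1 hA').1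
    obtain ⟨i, hi⟩ := h.nonempty A hAB.1
    exact disjoint_left.1 ((h.isSetPartition_childrenOf h.top_mem hS).disjoint
      B hB C hC hBC) (hAB.2 hi) (hAC.2 hi)

/-- Decomposition of a sum over hierarchies at the top. -/
theorem hierarchySum_eq_sum_setPartitions (w : Finset α → Finset (Finset α) → ℂ) {S : Finset α}
    (hS : 2 ≤ #S) :
    hierarchySum w S = ∑ π ∈ setPartitions S with S ∉ π, w S π * ∏ B ∈ π, hierarchySum w B := by
  have hne : S.Nonempty := card_pos.1 (by omega)
  rw [hierarchySum, ← sum_fiberwise_of_maps_to (t := (setPartitions S).filter (S ∉ ·))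
    (g := fun F => childrenOf F S)]
  swap
  · intro F hF
    have hF' := mem_hierarchies.1 hF
    exact mem_filter.2 ⟨mem_setPartitions.2 (hF'.isSetPartition_childrenOf hF'.top_mem hS),
      not_mem_childrenOf_self⟩
  refine sum_congr rfl fun π hπ => ?_
  obtain ⟨hπ, hSπ⟩ := mem_filter.1 hπ
  rw [mem_setPartitions] at hπ
  simp only [hierarchySum]
  -- Expanding the product gives a sum over choices of one hierarchy for each block; restriction to
  -- the blocks and gluing are mutually inverse.
  rw [prod_sum, mul_sum]
  refine sum_bij' (fun F _ => fun B _ => F.filter (· ⊆ B)) (fun f _ => glueHierarchy S π f)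
    ?_ ?_ ?_ ?_ ?_
  · intro F hF
    obtain ⟨hF, hFπ⟩ := mem_filter.1 hF
    refine mem_pi.2 fun B hB => mem_hierarchies.2 ((mem_hierarchies.1 hF).restrict ?_)
    rw [← hFπ] at hB
    exact (mem_childrenOf.1 hB).1
  · intro f hf
    have hf' := fun B hB => mem_hierarchies.1 (mem_pi.1 hf B hB)
    exact mem_filter.2 ⟨mem_hierarchies.2 (isHierarchy_glueHierarchy hne hπ hf'),
      childrenOf_glueHierarchy hπ hSπ hf'⟩
  · intro F hF
    have hF' := mem_hierarchies.1 (mem_filter.1 hF).1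
    have hFπ := (mem_filter.1 hF).2
    subst hFπ
    exact hF'.glueHierarchy_restrict
  · intro f hf
    have hf' := fun B hB => mem_hierarchies.1 (mem_pi.1 hf B hB)
    funext B hB
    exact filter_glueHierarchy hπ hSπ hf' hB
  · intro F hF
    have hF' := mem_hierarchies.1 (mem_filter.1 hF).1
    have hFπ := (mem_filter.1 hF).2
    rw [hF'.prod_eq_mul_prod_childrenOf hS, hFπ, ← prod_attach π]
    refine congrArg _ (prod_congr rfl fun B _ => prod_congr rfl fun A hA => ?_)
    rw [childrenOf_filter_subset (mem_filter.1 (mem_filter.1 hA).1).2]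

lemma hierarchies_singleton (i : α) : hierarchies ({i} : Finset α) = {{{i}}} := by
  ext F
  rw [mem_hierarchies, mem_singleton]
  constructor
  · intro h
    ext A
    rw [mem_singleton]
    constructor
    · intro hA
      exact (subset_singleton_iff.1 (h.subset A hA)).resolve_left (h.nonempty A hA).ne_empty
    · rintro rfl
      exact h.top_mem
  · rintro rfl
    constructor <;> simp

@[simp] lemma hierarchySum_singleton (w : Finset α → Finset (Finset α) → ℂ) (i : α) :
    hierarchySum w {i} = 1 := by
  simp [hierarchySum, hierarchies_singleton, filter_singleton]

lemma IsHierarchy.map_equiv {S : Finset α} {F : Finset (Finset α)} (h : IsHierarchy S F)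
    (e : α ≃ α) :
    IsHierarchy (S.map e.toEmbedding) (F.map (mapEmbedding e.toEmbedding).toEmbedding) := by
  constructor
  · exact mem_map_of_mem _ h.top_mem
  · intro A hA
    obtain ⟨A₀, hA₀, rfl⟩ := mem_map.1 hA
    exact map_subset_map.2 (h.subset A₀ hA₀)
  · intro A hA
    obtain ⟨A₀, hA₀, rfl⟩ := mem_map.1 hA
    exact (h.nonempty A₀ hA₀).map
  · intro i hi
    obtain ⟨j, hj, rfl⟩ := mem_map.1 hi
    exact mem_map.2 ⟨{j}, h.singleton_mem j hj, map_singleton _ _⟩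
  · intro A hA B hB
    obtain ⟨A₀, hA₀, rfl⟩ := mem_map.1 hA
    obtain ⟨B₀, hB₀, rfl⟩ := mem_map.1 hB
    simpa using h.laminar A₀ hA₀ B₀ hB₀

lemma childrenOf_map_equiv (F : Finset (Finset α)) (A : Finset α) (e : α ≃ α) :
    childrenOf (F.map (mapEmbedding e.toEmbedding).toEmbedding) (A.map e.toEmbedding) =
      (childrenOf F A).map (mapEmbedding e.toEmbedding).toEmbedding := by
  ext B
  simp only [mem_childrenOf, mem_map]
  constructor
  · rintro ⟨⟨B, hB, rfl⟩, hBA, h⟩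
    refine ⟨B, ⟨hB, map_ssubset_map.1 hBA, fun C hC hBC hCA => ?_⟩, rfl⟩
    exact h _ ⟨C, hC, rfl⟩ (map_ssubset_map.2 hBC) (map_ssubset_map.2 hCA)
  · rintro ⟨B, ⟨hB, hBA, h⟩, rfl⟩
    refine ⟨⟨B, hB, rfl⟩, map_ssubset_map.2 hBA, ?_⟩
    rintro _ ⟨C, hC, rfl⟩ hBC hCA
    exact h C hC (map_ssubset_map.1 hBC) (map_ssubset_map.1 hCA)

/-- Sums over hierarchies with weights that only depend on the number of children are invariant
under permutations. -/
lemma hierarchySum_map_equiv (c : ℕ → ℂ) (e : α ≃ α) (S : Finset α) :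
    hierarchySum (fun _ π => c #π) (S.map e.toEmbedding) = hierarchySum (fun _ π => c #π) S := by
  have hinv : ∀ (e : α ≃ α) (A : Finset α),
      (A.map e.toEmbedding).map e.symm.toEmbedding = A := by
    intro e A
    ext x
    simp
  have hinv' : ∀ (e : α ≃ α) (F : Finset (Finset α)),
      (F.map (mapEmbedding e.toEmbedding).toEmbedding).map
        (mapEmbedding e.symm.toEmbedding).toEmbedding = F := by
    intro e F
    ext A
    simp [hinv]
  symm
  refine sum_nbij' (fun F => F.map (mapEmbedding e.toEmbedding).toEmbedding)
    (fun F => F.map (mapEmbedding e.symm.toEmbedding).toEmbedding) ?_ ?_ ?_ ?_ ?_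
  · exact fun F hF => mem_hierarchies.2 ((mem_hierarchies.1 hF).map_equiv e)
  · intro F hF
    have := (mem_hierarchies.1 hF).map_equiv e.symm
    rw [hinv] at this
    exact mem_hierarchies.2 this
  · exact fun F _ => hinv' e F
  · exact fun F _ => hinv' e.symm F
  · intro F _
    rw [filter_map, prod_map]
    refine prod_congr (filter_congr fun A _ => ?_) fun A _ => ?_
    · simp
    · simp [childrenOf_map_equiv]

end

/-! ### Set partitions, the inverse power series and the cancellation. -/

lemma IsSetPartition.singleton {α : Type*} {S : Finset α} (hS : S.Nonempty) :
    IsSetPartition S {S} := by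
  constructor <;> simp [hS]

section

variable {α : Type*} [DecidableEq α]

namespace IsSetPartition

variable {S T : Finset α} {π π' Q : Finset (Finset α)}

lemma biUnion_eq (h : IsSetPartition S π) : π.biUnion id = S := by
  ext i
  simp only [mem_biUnion, id]
  exact ⟨fun ⟨B, hB, hi⟩ => h.subset B hB hi, fun hi => h.cover i hi⟩

lemma of_subset (h : IsSetPartition S π) (hQ : Q ⊆ π) : IsSetPartition (Q.biUnion id) Q where
  nonempty B hB := h.nonempty B (hQ hB)
  disjoint B hB C hC := h.disjoint B (hQ hB) C (hQ hC)
  subset _ hB := subset_biUnion_of_mem id hB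
  cover i hi := by simpa using hi

lemma biUnion_sdiff (h : IsSetPartition S π) (hQ : Q ⊆ π) :
    (π \ Q).biUnion id = S \ Q.biUnion id := by
  ext i
  simp only [mem_biUnion, mem_sdiff, id, not_exists, not_and]
  constructor
  · rintro ⟨B, ⟨hB, hBQ⟩, hi⟩
    refine ⟨h.subset B hB hi, fun C hC hiC => ?_⟩
    exact disjoint_left.1 (h.disjoint B hB C (hQ hC) (fun he => hBQ (he ▸ hC))) hi hiC
  · rintro ⟨hi, hn⟩
    obtain ⟨B, hB, hiB⟩ := h.cover i hi
    exact ⟨B, ⟨hB, fun hBQ => hn B hBQ hiB⟩, hiB⟩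

lemma disjoint_of_sdiff (h : IsSetPartition T π) (h' : IsSetPartition (S \ T) π') :
    Disjoint π π' := by
  refine disjoint_left.2 fun B hB hB' => ?_
  obtain ⟨i, hi⟩ := h.nonempty B hB
  exact (mem_sdiff.1 (h'.subset B hB' hi)).2 (h.subset B hB hi)

lemma union (hT : T ⊆ S) (h : IsSetPartition T π) (h' : IsSetPartition (S \ T) π') :
    IsSetPartition S (π ∪ π') where
  nonempty B hB := (mem_union.1 hB).elim (h.nonempty B) (h'.nonempty B)
  disjoint B hB C hC hBC := by
    have hd : ∀ B ∈ π, ∀ C ∈ π', Disjoint B C := fun B hB C hC =>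
      disjoint_of_subset_left (h.subset B hB)
        (disjoint_of_subset_right (h'.subset C hC) disjoint_sdiff)
    rcases mem_union.1 hB with hB | hB <;> rcases mem_union.1 hC with hC | hC
    · exact h.disjoint B hB C hC hBC
    · exact hd B hB C hC
    · exact (hd C hC B hB).symm
    · exact h'.disjoint B hB C hC hBC
  subset B hB := (mem_union.1 hB).elim (fun hB => (h.subset B hB).trans hT)
    (fun hB => (h'.subset B hB).trans sdiff_subset)
  cover i hi := by
    by_cases hiT : i ∈ T
    · obtain ⟨B, hB, hiB⟩ := h.cover i hiT
      exact ⟨B, mem_union_left _ hB, hiB⟩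
    · obtain ⟨B, hB, hiB⟩ := h'.cover i (mem_sdiff.2 ⟨hi, hiT⟩)
      exact ⟨B, mem_union_right _ hB, hiB⟩

lemma eq_singleton (h : IsSetPartition S π) (hS : S ∈ π) : π = {S} := by
  refine eq_singleton_iff_unique_mem.2 ⟨hS, fun B hB => ?_⟩
  by_contra hne
  obtain ⟨i, hi⟩ := h.nonempty B hB
  exact disjoint_left.1 (h.disjoint B hB S hS hne) hi (h.subset B hB hi)

end IsSetPartition

lemma sum_setPartitions_eq_add {S : Finset α} (hS : S.Nonempty) (g : Finset (Finset α) → ℂ) :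
    ∑ π ∈ setPartitions S, g π = g {S} + ∑ π ∈ setPartitions S with S ∉ π, g π := by
  rw [← sum_filter_add_sum_filter_not (setPartitions S) (S ∈ ·)]
  congr 1
  refine sum_eq_single_of_mem _ (mem_filter.2 ⟨mem_setPartitions.2 (.singleton hS), by simp⟩) ?_
  intro π hπ hne
  obtain ⟨hπ, hSπ⟩ := mem_filter.1 hπ
  exact absurd ((mem_setPartitions.1 hπ).eq_singleton hSπ) hne

/-- Choosing some blocks of a partition of `S` amounts to choosing a subset `T` and partitions
of `T` and `S \ T`. -/
lemma sum_setPartitions_powerset (S : Finset α)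
    (g : Finset (Finset α) → Finset (Finset α) → ℂ) :
    ∑ π ∈ setPartitions S, ∑ Q ∈ π.powerset, g Q (π \ Q) =
      ∑ T ∈ S.powerset, ∑ π ∈ setPartitions T, ∑ π' ∈ setPartitions (S \ T), g π π' := by
  simp only [sum_sigma']
  refine sum_bij' (fun x _ => ⟨x.2.biUnion id, x.2, x.1 \ x.2⟩)
    (fun y _ => ⟨y.2.1 ∪ y.2.2, y.2.1⟩) ?_ ?_ ?_ ?_ ?_
  · rintro ⟨π, Q⟩ h
    simp only [mem_sigma, mem_setPartitions, mem_powerset] at h ⊢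
    obtain ⟨hπ, hQ⟩ := h
    refine ⟨biUnion_subset.2 fun B hB => hπ.subset B (hQ hB), hπ.of_subset hQ, ?_⟩
    rw [← hπ.biUnion_sdiff hQ]
    exact hπ.of_subset sdiff_subset
  · rintro ⟨T, π, π'⟩ h
    simp only [mem_sigma, mem_setPartitions, mem_powerset] at h ⊢
    exact ⟨.union h.1 h.2.1 h.2.2, subset_union_left⟩
  · rintro ⟨π, Q⟩ h
    simp only [mem_sigma, mem_setPartitions, mem_powerset] at h
    simp [union_sdiff_of_subset h.2]
  · rintro ⟨T, π, π'⟩ h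
    simp only [mem_sigma, mem_setPartitions, mem_powerset] at h
    simp [h.2.1.biUnion_eq, union_sdiff_cancel_left (h.2.1.disjoint_of_sdiff h.2.2)]
  · rintro ⟨π, Q⟩ h
    rfl

/-- The exponential coefficients of the inverse of a power series with exponential coefficients
`c`, as a sum over hierarchies. -/
noncomputable def inverseCoeff (c : ℕ → ℂ) (S : Finset α) : ℂ :=
  hierarchySum (fun _ π => -c #π) S

/-- A permutation carrying `S` to `T` transports hierarchies and keeps the numbers of children. This
makes the final constant independent of which external edge is the root. -/
lemma inverseCoeff_eq_of_card [Fintype α] (c : ℕ → ℂ) {S T : Finset α} (h : #S = #T) :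
    inverseCoeff c S = inverseCoeff c T := by
  obtain ⟨e, rfl⟩ : ∃ e : α ≃ α, S.map e.toEmbedding = T := by
    let e₀ : {x // x ∈ S} ≃ {x // x ∈ T} := Finset.equivOfCardEq h
    refine ⟨e₀.extendSubtype, ?_⟩
    refine eq_of_subset_of_card_le (fun y hy => ?_) (by rw [card_map, h])
    obtain ⟨x, hx, rfl⟩ := mem_map.1 hy
    exact e₀.extendSubtype_mem x hx
  exact (hierarchySum_map_equiv (fun j => -c j) e S).symm

/-- The coefficients of the composition of a power series with its inverse vanish from degree two
on. -/
lemma sum_setPartitions_inverseCoeff {c : ℕ → ℂ} (hc : c 1 = 1) {S : Finset α} (hS : 2 ≤ #S) :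
    ∑ π ∈ setPartitions S, c #π * ∏ B ∈ π, inverseCoeff c B = 0 := by
  -- The one-block partition contributes `inverseCoeff c S`, whose expansion at the top is minus the
  -- sum over the other partitions.
  rw [sum_setPartitions_eq_add (card_pos.1 (by omega)), prod_singleton, card_singleton, hc,
    inverseCoeff, hierarchySum_eq_sum_setPartitions _ hS]
  simp [inverseCoeff]

/-- The weight of a vertex with child blocks `π`, where `f T` is the offshell variable of the
momentum of `T`. -/
noncomputable def vertexWeight (c : ℕ → ℂ) (f : Finset α → ℂ) (π : Finset (Finset α)) : ℂ :=
  ∑ Q ∈ π.powerset, c #Q * c (#π + 1 - #Q) * f (Q.biUnion id)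

/-- One child block means a two-valent vertex, which is the kinetic term itself. -/
lemma vertexWeight_singleton {c : ℕ → ℂ} (hc0 : c 0 = 0) (hc : c 1 = 1) (f : Finset α → ℂ)
    (S : Finset α) : vertexWeight c f {S} = f S := by
  have h : ({S} : Finset (Finset α)).powerset = {∅, {S}} := by
    ext Q
    simp [subset_singleton_iff]
  rw [vertexWeight, h, sum_pair (singleton_ne_empty S).symm]
  simp [hc0, hc]

/-- Grouping by the union `T` of the chosen blocks splits off the coefficient of `φ ∘ φ⁻¹` at `T`.
It vanishes for `2 ≤ #T`; a singleton `T` is killed by `hf`, the empty one by `hc0`. -/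
lemma sum_vertexWeight_eq_zero {c : ℕ → ℂ} (hc0 : c 0 = 0) (hc : c 1 = 1) {f : Finset α → ℂ}
    {S : Finset α} (hf : ∀ i ∈ S, f {i} = 0) :
    ∑ π ∈ setPartitions S, vertexWeight c f π * ∏ B ∈ π, inverseCoeff c B = 0 := by
  -- The edges outside `Q` are the remaining blocks `R` and the edge towards the root, whence the
  -- index `#R + 1`.
  let g : Finset (Finset α) → Finset (Finset α) → ℂ := fun Q R => f (Q.biUnion id) *
    (c #Q * ∏ B ∈ Q, inverseCoeff c B) * (c (#R + 1) * ∏ B ∈ R, inverseCoeff c B)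
  have hg : ∀ π ∈ setPartitions S, vertexWeight c f π * ∏ B ∈ π, inverseCoeff c B =
      ∑ Q ∈ π.powerset, g Q (π \ Q) := by
    intro π _
    rw [vertexWeight, sum_mul]
    refine sum_congr rfl fun Q hQ => ?_
    have hQ' := mem_powerset.1 hQ
    have hle := card_le_card hQ'
    simp only [g]
    rw [← prod_sdiff hQ', card_sdiff_of_subset hQ', Nat.sub_add_comm hle]
    ring
  rw [sum_congr rfl hg, sum_setPartitions_powerset S g]
  refine sum_eq_zero fun T hT => ?_
  have hbi : ∀ π ∈ setPartitions T, ∑ π' ∈ setPartitions (S \ T), g π π' =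
      f T * (c #π * ∏ B ∈ π, inverseCoeff c B) *
        ∑ π' ∈ setPartitions (S \ T), c (#π' + 1) * ∏ B ∈ π', inverseCoeff c B := by
    intro π hπ
    simp only [g]
    rw [(mem_setPartitions.1 hπ).biUnion_eq, mul_sum]
  rw [sum_congr rfl hbi, ← sum_mul, ← mul_sum]
  rcases Nat.lt_or_ge #T 2 with h | h
  · rcases Nat.lt_or_ge #T 1 with h0 | h1
    · have hT0 : T = ∅ := card_eq_zero.1 (by omega)
      subst hT0
      have : ∀ π ∈ setPartitions (∅ : Finset α), c #π * ∏ B ∈ π, inverseCoeff c B = 0 := by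
        intro π hπ
        have hπ0 : π = ∅ := eq_empty_of_forall_notMem fun B hB => by
          obtain ⟨i, hi⟩ := (mem_setPartitions.1 hπ).nonempty B hB
          exact notMem_empty i ((mem_setPartitions.1 hπ).subset B hB hi)
        simp [hπ0, hc0]
      rw [sum_eq_zero this]
      simp
    · obtain ⟨i, rfl⟩ := card_eq_one.1 (by omega : #T = 1)
      rw [hf i (by simpa using hT)]
      simp
  · rw [sum_setPartitions_inverseCoeff hc h]
    simp

/-- Evaluation of the tree sum in terms of hierarchies: if the propagators `p A` cancel the
offshell variables `f A` and all leaves are onshell, only the top propagator survives. -/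
theorem hierarchySum_vertexWeight {c : ℕ → ℂ} (hc0 : c 0 = 0) (hc : c 1 = 1)
    {f p : Finset α → ℂ} {S : Finset α} (hS : 2 ≤ #S) (hf : ∀ i ∈ S, f {i} = 0)
    (hp : ∀ A, A ⊂ S → 2 ≤ #A → p A * f A = -1) :
    hierarchySum (fun A π => p A * vertexWeight c f π) S = -(p S * f S) * inverseCoeff c S := by
  induction S using Finset.strongInduction with
  | H S ih =>
    have hne : S.Nonempty := card_pos.1 (by omega)
    -- On a proper block with at least two elements `p B * f B = -1` reduces the induction
    -- hypothesis to `inverseCoeff c B`; on a singleton both sides are `1`.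
    have hB : ∀ B, B ⊂ S → B.Nonempty →
        hierarchySum (fun A π => p A * vertexWeight c f π) B = inverseCoeff c B := by
      intro B hBS hBne
      rcases Nat.lt_or_ge #B 2 with h | h
      · obtain ⟨i, rfl⟩ := card_eq_one.1 (by have := card_pos.2 hBne; omega : #B = 1)
        simp [inverseCoeff]
      · rw [ih B hBS h (fun i hi => hf i (hBS.1 hi)) (fun A hA => hp A (hA.trans hBS)),
          hp B hBS h]
        ring
    rw [hierarchySum_eq_sum_setPartitions _ hS]
    have hprod : ∀ π ∈ (setPartitions S).filter (S ∉ ·),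
        p S * vertexWeight c f π *
          ∏ B ∈ π, hierarchySum (fun A π => p A * vertexWeight c f π) B =
        p S * (vertexWeight c f π * ∏ B ∈ π, inverseCoeff c B) := by
      intro π hπ
      obtain ⟨hπ, hSπ⟩ := mem_filter.1 hπ
      rw [mem_setPartitions] at hπ
      rw [prod_congr rfl fun B hBπ => hB B
        ((hπ.subset B hBπ).ssubset_of_ne (fun h => hSπ (h ▸ hBπ))) (hπ.nonempty B hBπ)]
      ring
    rw [sum_congr rfl hprod, ← mul_sum]
    have h0 := sum_vertexWeight_eq_zero hc0 hc hf
    -- The vanishing total contains the one-block term `f S * inverseCoeff c S`, so the remaining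
    -- partitions sum to its negative.
    rw [sum_setPartitions_eq_add hne, vertexWeight_singleton hc0 hc, prod_singleton] at h0
    rw [eq_neg_of_add_eq_zero_right h0]
    ring

end

/-! ### Rooted trees and ancestors. -/

/-- The graph `G` is a tree with root `r` and parent map `P`, where `lev` decreases along `P`. -/
structure IsRootedTree {V : Type*} (G : SimpleGraph V) (r : V) (P : V → V) (lev : V → ℕ) :
    Prop where
  parent_root : P r = r
  lev_parent : ∀ x, x ≠ r → lev x = lev (P x) + 1
  adj_iff : ∀ x y, G.Adj x y ↔ (x ≠ r ∧ y = P x) ∨ (y ≠ r ∧ x = P y)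

/-- `x` is an iterated parent of `y`. -/
def IsAncestor {V : Type*} (P : V → V) (x y : V) : Prop := ∃ n : ℕ, P^[n] y = x

/-- The parent of `x` is the penultimate vertex on the path from `r` to `x`, and the level is the
distance from `r`. Adjacent vertices of a tree differ by one in level, and uniqueness of paths
identifies the lower of the two as the parent. -/
lemma SimpleGraph.IsTree.exists_isRootedTree {V : Type*} {G : SimpleGraph V} (hG : G.IsTree)
    (r : V) : ∃ P lev, IsRootedTree G r P lev := by
  classical
  choose w hw hlen using fun x => (hG.connected r x).exists_path_of_dist
  have hpar : ∀ x y, G.Adj x y → G.dist r x = G.dist r y + 1 →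
      x ≠ r ∧ y = (w x).penultimate := by
    intro x y hxy hd
    refine ⟨fun h => ?_, ?_⟩
    · rw [h, SimpleGraph.dist_self] at hd
      omega
    · have hp : ((w y).concat hxy.symm).IsPath := by
        refine SimpleGraph.Walk.isPath_of_length_eq_dist _ ?_
        rw [SimpleGraph.Walk.length_concat, hlen, hd]
      rw [(hG.existsUnique_path r x).unique (hw x) hp, SimpleGraph.Walk.penultimate_concat]
  have hnil : ∀ x, x ≠ r → ¬ (w x).Nil := fun x hx h => hx h.eq.symm
  have hlev : ∀ x, x ≠ r → G.dist r x = G.dist r (w x).penultimate + 1 := by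
    intro x hx
    have h1 := SimpleGraph.dist_le (w x).dropLast
    have h2 := (w x).adj_penultimate (hnil x hx)
    have h3 : (w x).dropLast.length + 1 = (w x).length :=
      SimpleGraph.Walk.length_dropLast_add_one (hnil x hx)
    rcases hG.dist_eq_dist_add_one_of_adj r h2 with h | h
    · rw [hlen] at h3
      omega
    · exact h
  refine ⟨fun x => if x = r then r else (w x).penultimate, fun x => G.dist r x, by simp, ?_, ?_⟩
  · intro x hx
    simpa [hx] using hlev x hx
  · intro x y
    constructor
    · intro hxy
      rcases hG.dist_eq_dist_add_one_of_adj r hxy with h | h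
      · obtain ⟨hx, hy⟩ := hpar x y hxy h
        exact Or.inl ⟨hx, by simpa [hx] using hy⟩
      · obtain ⟨hx, hy⟩ := hpar y x hxy.symm h
        exact Or.inr ⟨hx, by simpa [hx] using hy⟩
    · rintro (⟨hx, hy⟩ | ⟨hx, hy⟩)
      · rw [if_neg hx] at hy
        exact hy ▸ ((w x).adj_penultimate (hnil x hx)).symm
      · rw [if_neg hx] at hy
        exact hy ▸ (w y).adj_penultimate (hnil y hx)

namespace IsAncestor

variable {V : Type*} {P : V → V} {x y z : V}

lemma refl (x : V) : IsAncestor P x x := ⟨0, rfl⟩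

lemma parent (h : IsAncestor P x (P y)) : IsAncestor P x y := by
  obtain ⟨n, hn⟩ := h
  exact ⟨n + 1, hn⟩

lemma parent_self (x : V) : IsAncestor P (P x) x := (refl _).parent

lemma of_ne (h : IsAncestor P x y) (hne : y ≠ x) : IsAncestor P x (P y) := by
  obtain ⟨n, hn⟩ := h
  cases n with
  | zero => exact absurd hn hne
  | succ n => exact ⟨n, hn⟩

lemma trans (hxy : IsAncestor P x y) (hyz : IsAncestor P y z) : IsAncestor P x z := by
  obtain ⟨n, rfl⟩ := hyz
  obtain ⟨m, rfl⟩ := hxy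
  exact ⟨m + n, Function.iterate_add_apply P m n z⟩

lemma total (hx : IsAncestor P x z) (hy : IsAncestor P y z) :
    IsAncestor P x y ∨ IsAncestor P y x := by
  obtain ⟨n, rfl⟩ := hx
  obtain ⟨m, rfl⟩ := hy
  rcases Nat.le_total n m with h | h
  · exact Or.inr ⟨m - n, by rw [← Function.iterate_add_apply, Nat.sub_add_cancel h]⟩
  · exact Or.inl ⟨n - m, by rw [← Function.iterate_add_apply, Nat.sub_add_cancel h]⟩

end IsAncestor

namespace IsRootedTree

variable {V : Type*} {G : SimpleGraph V} {r : V} {P : V → V} {lev : V → ℕ}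

lemma root_induction (h : IsRootedTree G r P lev) {p : V → Prop} (hr : p r)
    (hs : ∀ x, x ≠ r → p (P x) → p x) (x : V) : p x := by
  induction hn : lev x using Nat.strong_induction_on generalizing x with
  | _ n ih =>
    by_cases hx : x = r
    · exact hx ▸ hr
    · exact hs x hx (ih _ (by have := h.lev_parent x hx; omega) _ rfl)

lemma adj_parent (h : IsRootedTree G r P lev) {x : V} (hx : x ≠ r) : G.Adj x (P x) :=
  (h.adj_iff x _).2 (Or.inl ⟨hx, rfl⟩)

lemma eq_root_of_isAncestor (h : IsRootedTree G r P lev) {x : V} (hx : IsAncestor P x r) :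
    x = r := by
  obtain ⟨n, rfl⟩ := hx
  exact Function.iterate_fixed h.parent_root n

lemma lev_le (h : IsRootedTree G r P lev) {x y : V} (hxy : IsAncestor P x y) :
    x = y ∨ lev x < lev y := by
  obtain ⟨n, hn⟩ := hxy
  induction n generalizing y with
  | zero => exact Or.inl hn.symm
  | succ n ih =>
    by_cases hy : y = r
    · subst hy
      exact Or.inl (h.eq_root_of_isAncestor ⟨_, hn⟩)
    · have := h.lev_parent y hy
      rcases ih hn with rfl | hlt
      · right; omega
      · right; omega

lemma antisymm (h : IsRootedTree G r P lev) {x y : V} (hxy : IsAncestor P x y)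
    (hyx : IsAncestor P y x) : x = y := by
  rcases h.lev_le hxy with h1 | h1
  · exact h1
  · rcases h.lev_le hyx with h2 | h2
    · exact h2.symm
    · omega

lemma parent_ne (h : IsRootedTree G r P lev) {x : V} (hx : x ≠ r) : P x ≠ x := by
  intro he
  have := h.lev_parent x hx
  rw [he] at this
  omega

lemma not_isAncestor_parent (h : IsRootedTree G r P lev) {x : V} (hx : x ≠ r) :
    ¬ IsAncestor P x (P x) := fun ha =>
  h.parent_ne hx (h.antisymm (.parent_self x) ha)

lemma adj_deleteEdges_parent (h : IsRootedTree G r P lev) {x y : V} (hx : x ≠ r) (hy : y ≠ r)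
    (hxy : y ≠ x) : (G.deleteEdges {s(x, P x)}).Adj y (P y) := by
  rw [SimpleGraph.deleteEdges_adj]
  refine ⟨h.adj_parent hy, ?_⟩
  simp only [Set.mem_singleton_iff, Sym2.eq_iff, not_or, not_and]
  refine ⟨fun he => absurd he hxy, fun h1 h2 => ?_⟩
  have e1 := h.lev_parent x hx
  have e2 := h.lev_parent y hy
  rw [← h1] at e1
  rw [h2] at e2
  omega

/-- Deleting the edge above `x` leaves connected to `x` exactly its descendants. -/
lemma reachable_deleteEdges_iff (h : IsRootedTree G r P lev) {x : V} (hx : x ≠ r) (y : V) :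
    (G.deleteEdges {s(x, P x)}).Reachable x y ↔ IsAncestor P x y := by
  constructor
  · rintro ⟨w⟩
    have key : ∀ {u v : V}, (G.deleteEdges {s(x, P x)}).Walk u v → IsAncestor P x u →
        IsAncestor P x v := by
      intro u v w
      induction w with
      | nil => exact id
      | cons hadj _ ih =>
        refine fun hu => ih ?_
        rename_i u v _ _
        obtain ⟨ha, hne⟩ := SimpleGraph.deleteEdges_adj.1 hadj
        rcases (h.adj_iff _ _).1 ha with ⟨-, rfl⟩ | ⟨-, rfl⟩
        · refine hu.of_ne ?_
          rintro rfl
          exact hne rfl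
        · exact hu.parent
    exact key w (.refl x)
  · rintro ⟨n, hn⟩
    induction n generalizing y with
    | zero => exact hn ▸ SimpleGraph.Reachable.refl _
    | succ n ih =>
      by_cases hyx : y = x
      · exact hyx ▸ SimpleGraph.Reachable.refl _
      · have hy : y ≠ r := by
          rintro rfl
          exact hx (h.eq_root_of_isAncestor ⟨_, hn⟩)
        exact (ih (P y) hn).trans (h.adj_deleteEdges_parent hx hy hyx).reachable.symm

/-- Deleting the edge above `x` leaves connected to its parent exactly the vertices that are not
descendants of `x`. -/
lemma reachable_parent_deleteEdges_iff (h : IsRootedTree G r P lev) {x : V} (hx : x ≠ r) (y : V) :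
    (G.deleteEdges {s(x, P x)}).Reachable (P x) y ↔ ¬ IsAncestor P x y := by
  constructor
  · intro hr ha
    exact h.not_isAncestor_parent hx ((h.reachable_deleteEdges_iff hx _).1
      (((h.reachable_deleteEdges_iff hx y).2 ha).trans hr.symm))
  -- The connection runs through the root: climbing from a vertex that is not below `x` never uses
  -- the deleted edge.
  · have key : ∀ y, ¬ IsAncestor P x y → (G.deleteEdges {s(x, P x)}).Reachable r y := by
      refine h.root_induction (fun _ => SimpleGraph.Reachable.refl _) fun y hy ih hn => ?_
      refine (ih fun ha => hn ha.parent).trans (SimpleGraph.Adj.reachable ?_)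
      exact (h.adj_deleteEdges_parent hx hy fun he => hn (he ▸ .refl _)).symm
    exact fun hn => (key _ (h.not_isAncestor_parent hx)).symm.trans (key y hn)

/-- Climbing to the root gives connectedness. Every edge is a bridge, since deleting it leaves only
descendants on the lower side. -/
lemma isTree (h : IsRootedTree G r P lev) : G.IsTree where
  connected := by
    have : Nonempty V := ⟨r⟩
    have key : ∀ x, G.Reachable x r := h.root_induction (SimpleGraph.Reachable.refl _)
      fun x hx ih => (h.adj_parent hx).reachable.trans ih
    exact ⟨fun x y => (key x).trans (key y).symm⟩
  isAcyclic := by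
    refine SimpleGraph.isAcyclic_iff_forall_adj_isBridge.2 fun x y hxy => ?_
    rcases (h.adj_iff x y).1 hxy with ⟨hx, rfl⟩ | ⟨hy, rfl⟩
    · rw [SimpleGraph.isBridge_iff, h.reachable_deleteEdges_iff hx]
      exact h.not_isAncestor_parent hx
    · rw [Sym2.eq_swap, SimpleGraph.isBridge_iff, h.reachable_deleteEdges_iff hy]
      exact h.not_isAncestor_parent hy

end IsRootedTree

/-! ### From Feynman trees to hierarchies: leaf sets. -/

/-- The set of external edges at or below a node, for a labelling `D` of the inner vertices. -/
def nodeSet {L M : Type*} (D : M → Finset L) : L ⊕ M → Finset L := Sum.elim singleton D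

/-- All node sets of the nodes other than the root. -/
def nodeFamily {L M : Type*} [Fintype L] [Fintype M] [DecidableEq L] [DecidableEq M] (r : L)
    (D : M → Finset L) : Finset (Finset L) :=
  (univ.erase (Sum.inl r)).image (nodeSet D)

/-- Labellings of the inner vertices by the nontrivial members of a hierarchy on `{r}ᶜ`. -/
structure IsHierarchyLabelling {L M : Type*} [Fintype L] [Fintype M] [DecidableEq L]
    [DecidableEq M] (r : L) (D : M → Finset L) : Prop where
  injective : Function.Injective D
  two_le : ∀ v, 2 ≤ #(D v)
  isHierarchy : IsHierarchy (univ.erase r) (nodeFamily r D)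

open Classical in
/-- The external edges below a node of a rooted tree. -/
noncomputable def leafSet {L M : Type*} [Fintype L] (P : L ⊕ M → L ⊕ M) (x : L ⊕ M) : Finset L :=
  univ.filter fun i => IsAncestor P x (Sum.inl i)

lemma mem_leafSet {L M : Type*} [Fintype L] {P : L ⊕ M → L ⊕ M} {x : L ⊕ M} {i : L} :
    i ∈ leafSet P x ↔ IsAncestor P x (Sum.inl i) := by
  simp [leafSet]

lemma IsRootedTree.parent_unique {V : Type*} {G : SimpleGraph V} {r : V} {P P' : V → V}
    {lev lev' : V → ℕ} (h : IsRootedTree G r P lev) (h' : IsRootedTree G r P' lev') : P' = P := by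
  funext x
  refine h.root_induction (p := fun x => P' x = P x) (h'.parent_root.trans h.parent_root.symm) ?_ x
  intro x hx ih
  rcases (h'.adj_iff x (P x)).1 (h.adj_parent hx) with ⟨-, h1⟩ | ⟨h1, h2⟩
  · exact h1.symm
  · have e1 := h.lev_parent x hx
    have e2 := h.lev_parent (P x) h1
    rw [← ih, ← h2] at e2
    omega

section

variable {L M : Type*} [Fintype L] [Fintype M]
  {G : SimpleGraph (L ⊕ M)} {r : L} {P : L ⊕ M → L ⊕ M} {lev : L ⊕ M → ℕ}

namespace IsRootedTree

lemma parent_ne_leaf (h : IsRootedTree G (Sum.inl r) P lev) (hF : IsFeynmanTree G) {i : L}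
    (hi : i ≠ r) {y : L ⊕ M} (hy : y ≠ Sum.inl r) : P y ≠ Sum.inl i := by
  intro he
  have hi' : (Sum.inl i : L ⊕ M) ≠ Sum.inl r := fun h => hi (Sum.inl_injective h)
  obtain ⟨a, ha⟩ := Set.ncard_eq_one.1 (hF.2.1 i)
  have h1 : P (Sum.inl i) ∈ G.neighborSet (Sum.inl i) := h.adj_parent hi'
  have h2 : y ∈ G.neighborSet (Sum.inl i) := he ▸ (h.adj_parent hy).symm
  rw [ha, Set.mem_singleton_iff] at h1 h2
  have e1 := h.lev_parent _ hi'
  have e2 := h.lev_parent _ hy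
  rw [h1] at e1
  rw [he, h2] at e2
  omega

lemma isAncestor_leaf_iff (h : IsRootedTree G (Sum.inl r) P lev) (hF : IsFeynmanTree G) {i : L}
    (hi : i ≠ r) {y : L ⊕ M} : IsAncestor P (Sum.inl i) y ↔ y = Sum.inl i := by
  constructor
  · rintro ⟨n, hn⟩
    induction n generalizing y with
    | zero => exact hn
    | succ n ih =>
      have hPy := ih hn
      by_cases hy : y = Sum.inl r
      · rw [hy, h.parent_root] at hPy
        exact absurd (Sum.inl_injective hPy).symm hi
      · exact absurd hPy (h.parent_ne_leaf hF hi hy)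
  · rintro rfl
    exact .refl _

/-- Of at least three neighbours only one can be the parent. -/
lemma exists_two_children (h : IsRootedTree G (Sum.inl r) P lev) (hF : IsFeynmanTree G) (v : M) :
    ∃ y z, y ≠ z ∧ y ≠ Sum.inl r ∧ z ≠ Sum.inl r ∧ P y = Sum.inr v ∧ P z = Sum.inr v := by
  have key : ∀ y ∈ G.neighborSet (Sum.inr v), y = P (Sum.inr v) ∨
      (y ≠ Sum.inl r ∧ P y = Sum.inr v) := by
    intro y hy
    rcases (h.adj_iff _ _).1 hy with ⟨-, h1⟩ | ⟨h1, h2⟩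
    · exact Or.inl h1
    · exact Or.inr ⟨h1, h2.symm⟩
  obtain ⟨a, b, c, ha, hb, hc, hab, hac, hbc⟩ :=
    (Set.two_lt_ncard_iff (Set.toFinite _)).1 (hF.2.2 v)
  rcases key a ha with ha | ha
  · have hb := (key b hb).resolve_left fun he => hab (ha.trans he.symm)
    have hc := (key c hc).resolve_left fun he => hac (ha.trans he.symm)
    exact ⟨b, c, hbc, hb.1, hc.1, hb.2, hc.2⟩
  · rcases key b hb with hb | hb
    · have hc := (key c hc).resolve_left fun he => hbc (hb.trans he.symm)
      exact ⟨a, c, hac, ha.1, hc.1, ha.2, hc.2⟩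
    · exact ⟨a, b, hab, ha.1, hb.1, ha.2, hb.2⟩

lemma isAncestor_of_root_child (h : IsRootedTree G (Sum.inl r) P lev) (hF : IsFeynmanTree G) :
    ∃ t, t ≠ Sum.inl r ∧ P t = Sum.inl r ∧ ∀ x, x ≠ Sum.inl r → IsAncestor P t x := by
  obtain ⟨t, ht⟩ := Set.ncard_eq_one.1 (hF.2.1 r)
  have htm : G.Adj (Sum.inl r) t := by
    have : t ∈ G.neighborSet (Sum.inl r) := ht ▸ rfl
    exact this
  obtain ⟨h1, h2⟩ : t ≠ Sum.inl r ∧ Sum.inl r = P t := by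
    rcases (h.adj_iff _ _).1 htm with ⟨h1, -⟩ | h1
    · exact absurd rfl h1
    · exact h1
  refine ⟨t, h1, h2.symm, h.root_induction (fun h => absurd rfl h) fun x hx ih _ => ?_⟩
  by_cases hP : P x = Sum.inl r
  · have : x ∈ G.neighborSet (Sum.inl r) := hP ▸ (h.adj_parent hx).symm
    rw [ht, Set.mem_singleton_iff] at this
    exact this ▸ .refl _
  · exact (ih hP).parent

lemma leafSet_nonempty (h : IsRootedTree G (Sum.inl r) P lev) (hF : IsFeynmanTree G)
    (x : L ⊕ M) : (leafSet P x).Nonempty := by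
  classical
  -- A deepest descendant of `x` is a leaf, because an inner vertex would have a still deeper child.
  obtain ⟨y, hy, hmax⟩ := (univ.filter fun y => IsAncestor P x y).exists_max_image lev
    ⟨x, by simp [IsAncestor.refl]⟩
  have hxy : IsAncestor P x y := by simpa using hy
  rcases y with i | v
  · exact ⟨i, mem_leafSet.2 hxy⟩
  · obtain ⟨z, -, -, hz, -, hPz, -⟩ := h.exists_two_children hF v
    have h1 := hmax z (by simpa using (hPz ▸ hxy).parent)
    have h2 := h.lev_parent z hz
    rw [hPz] at h2
    omega

lemma leafSet_subset (x y : L ⊕ M) (hxy : IsAncestor P x y) : leafSet P y ⊆ leafSet P x :=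
  fun _ hi => mem_leafSet.2 (hxy.trans (mem_leafSet.1 hi))

lemma leafSet_disjoint {x y : L ⊕ M} (hxy : ¬ IsAncestor P x y) (hyx : ¬ IsAncestor P y x) :
    Disjoint (leafSet P x) (leafSet P y) := by
  refine disjoint_left.2 fun i hx hy => ?_
  rcases (mem_leafSet.1 hx).total (mem_leafSet.1 hy) with h | h
  · exact hxy h
  · exact hyx h

lemma not_isAncestor_sibling (h : IsRootedTree G (Sum.inl r) P lev) {y z : L ⊕ M}
    (hy : y ≠ Sum.inl r) (hyz : y ≠ z) (hP : P y = P z) : ¬ IsAncestor P y z := fun ha =>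
  h.not_isAncestor_parent hy (hP ▸ ha.of_ne hyz.symm)

lemma leafSet_inl (h : IsRootedTree G (Sum.inl r) P lev) (hF : IsFeynmanTree G) {i : L}
    (hi : i ≠ r) : leafSet P (Sum.inl i) = {i} := by
  ext j
  rw [mem_leafSet, h.isAncestor_leaf_iff hF hi, mem_singleton, Sum.inl_injective.eq_iff]

/-- Besides the child leading to `y`, the vertex has another child, and the leaves under that one
are missing below `y`. Valence at least three is essential: a two-valent vertex would share its leaf
set with its only child. -/
lemma leafSet_ssubset (h : IsRootedTree G (Sum.inl r) P lev) (hF : IsFeynmanTree G)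
    {x y : L ⊕ M} (hx : x ≠ Sum.inl r) (hxy : IsAncestor P x y) (hne : y ≠ x) :
    leafSet P y ⊂ leafSet P x := by
  rcases x with i | v
  · exact absurd ((h.isAncestor_leaf_iff hF fun he => hx (he ▸ rfl)).1 hxy) hne
  · -- the child of `v` above `y`
    obtain ⟨c, hc, hPc, hcy⟩ : ∃ c, c ≠ Sum.inl r ∧ P c = Sum.inr v ∧ IsAncestor P c y := by
      have key : ∀ y, IsAncestor P (Sum.inr v) y → y ≠ Sum.inr v →
          ∃ c, c ≠ Sum.inl r ∧ P c = Sum.inr v ∧ IsAncestor P c y := by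
        refine h.root_induction (fun ha => absurd (h.eq_root_of_isAncestor ha) hx) ?_
        intro y hy ih ha hne
        by_cases hP : P y = Sum.inr v
        · exact ⟨y, hy, hP, .refl y⟩
        · obtain ⟨c, h1, h2, h3⟩ := ih (ha.of_ne hne) hP
          exact ⟨c, h1, h2, h3.parent⟩
      exact key y hxy hne
    obtain ⟨z, hz, hPz, hzc⟩ : ∃ z, z ≠ Sum.inl r ∧ P z = Sum.inr v ∧ z ≠ c := by
      obtain ⟨a, b, hab, ha, hb, hPa, hPb⟩ := h.exists_two_children hF v
      by_cases hac : a = c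
      · exact ⟨b, hb, hPb, fun he => hab (hac.trans he.symm)⟩
      · exact ⟨a, ha, hPa, hac⟩
    refine (leafSet_subset _ _ hxy).ssubset_of_ne fun he => ?_
    obtain ⟨i, hi⟩ := h.leafSet_nonempty hF z
    have h1 : i ∈ leafSet P (Sum.inr v) := leafSet_subset _ _ (hPz ▸ .parent_self z) hi
    have h2 : i ∈ leafSet P c := leafSet_subset _ _ hcy (he ▸ h1)
    exact disjoint_left.1 (leafSet_disjoint
      (h.not_isAncestor_sibling hz hzc (hPz.trans hPc.symm))
      (h.not_isAncestor_sibling hc hzc.symm (hPc.trans hPz.symm))) hi h2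

lemma leafSet_subset_iff (h : IsRootedTree G (Sum.inl r) P lev) (hF : IsFeynmanTree G)
    {x y : L ⊕ M} (hy : y ≠ Sum.inl r) :
    leafSet P y ⊆ leafSet P x ↔ IsAncestor P x y := by
  refine ⟨fun hs => ?_, leafSet_subset x y⟩
  by_contra hxy
  by_cases hyx : IsAncestor P y x
  · exact (h.leafSet_ssubset hF hy hyx fun he => hxy (he ▸ .refl _)).2 hs
  · obtain ⟨i, hi⟩ := h.leafSet_nonempty hF y
    exact disjoint_left.1 (leafSet_disjoint hxy hyx) (hs hi) hi

lemma leafSet_injOn (h : IsRootedTree G (Sum.inl r) P lev) (hF : IsFeynmanTree G)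
    {x y : L ⊕ M} (hx : x ≠ Sum.inl r) (hy : y ≠ Sum.inl r) (he : leafSet P x = leafSet P y) :
    x = y :=
  h.antisymm ((h.leafSet_subset_iff hF hy).1 he.ge) ((h.leafSet_subset_iff hF hx).1 he.le)

lemma leafSet_ssubset_iff (h : IsRootedTree G (Sum.inl r) P lev) (hF : IsFeynmanTree G)
    {x y : L ⊕ M} (hx : x ≠ Sum.inl r) (hy : y ≠ Sum.inl r) :
    leafSet P y ⊂ leafSet P x ↔ IsAncestor P x y ∧ y ≠ x := by
  constructor
  · intro hs
    exact ⟨(h.leafSet_subset_iff hF hy).1 hs.1, fun he => hs.ne (he ▸ rfl)⟩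
  · exact fun ⟨h1, h2⟩ => h.leafSet_ssubset hF hx h1 h2

lemma root_notMem_leafSet (h : IsRootedTree G (Sum.inl r) P lev) {x : L ⊕ M}
    (hx : x ≠ Sum.inl r) : r ∉ leafSet P x :=
  fun hr => hx (h.eq_root_of_isAncestor (mem_leafSet.1 hr))

variable [DecidableEq L] [DecidableEq M]

/-- All other nodes lie below the unique neighbour of the root. This recognises the node whose upper
edge is the external edge `r`, which carries no propagator. -/
lemma leafSet_eq_erase_iff (h : IsRootedTree G (Sum.inl r) P lev) (hF : IsFeynmanTree G)
    {x : L ⊕ M} (hx : x ≠ Sum.inl r) : leafSet P x = univ.erase r ↔ P x = Sum.inl r := by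
  obtain ⟨t, ht, hPt, hanc⟩ := h.isAncestor_of_root_child hF
  have hts : leafSet P t = univ.erase r := by
    ext i
    rw [mem_leafSet, mem_erase, and_iff_left (mem_univ i)]
    constructor
    · rintro ha rfl
      exact ht (h.eq_root_of_isAncestor ha)
    · exact fun hi => hanc _ fun he => hi (Sum.inl_injective he)
  constructor
  · intro he
    rw [h.leafSet_injOn hF hx ht (he.trans hts.symm), hPt]
  · intro hP
    have hxt : x = t := by
      by_contra hne
      exact h.not_isAncestor_sibling ht (fun he => hne he.symm) (hPt.trans hP.symm) (hanc x hx)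
    rw [hxt, hts]

lemma nodeSet_leafSet (h : IsRootedTree G (Sum.inl r) P lev) (hF : IsFeynmanTree G)
    {x : L ⊕ M} (hx : x ≠ Sum.inl r) :
    nodeSet (fun v => leafSet P (Sum.inr v)) x = leafSet P x := by
  rcases x with i | v
  · exact (h.leafSet_inl hF fun he => hx (he ▸ rfl)).symm
  · rfl

lemma mem_nodeFamily_leafSet (h : IsRootedTree G (Sum.inl r) P lev) (hF : IsFeynmanTree G)
    {A : Finset L} : A ∈ nodeFamily r (fun v : M => leafSet P (Sum.inr v)) ↔
      ∃ x, x ≠ Sum.inl r ∧ leafSet P x = A := by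
  simp only [nodeFamily, mem_image, mem_erase, mem_univ, and_true]
  constructor
  · rintro ⟨x, hx, rfl⟩
    exact ⟨x, hx, (h.nodeSet_leafSet hF hx).symm⟩
  · rintro ⟨x, hx, rfl⟩
    exact ⟨x, hx, h.nodeSet_leafSet hF hx⟩

lemma isHierarchyLabelling (h : IsRootedTree G (Sum.inl r) P lev) (hF : IsFeynmanTree G) :
    IsHierarchyLabelling r fun v : M => leafSet P (Sum.inr v) where
  injective v w he := Sum.inr_injective (h.leafSet_injOn hF Sum.inr_ne_inl Sum.inr_ne_inl he)
  two_le v := by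
    obtain ⟨y, -, -, hy, -, hPy, -⟩ := h.exists_two_children hF v
    have h1 := card_lt_card (h.leafSet_ssubset hF Sum.inr_ne_inl (hPy ▸ .parent_self y)
      fun he => h.parent_ne hy (hPy.trans he.symm))
    have h2 := card_pos.2 (h.leafSet_nonempty hF y)
    omega
  isHierarchy := by
    constructor
    · obtain ⟨t, ht, hPt, -⟩ := h.isAncestor_of_root_child hF
      exact (h.mem_nodeFamily_leafSet hF).2 ⟨t, ht, (h.leafSet_eq_erase_iff hF ht).2 hPt⟩
    · intro A hA
      obtain ⟨x, hx, rfl⟩ := (h.mem_nodeFamily_leafSet hF).1 hA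
      exact subset_erase.2 ⟨subset_univ _, h.root_notMem_leafSet hx⟩
    · intro A hA
      obtain ⟨x, hx, rfl⟩ := (h.mem_nodeFamily_leafSet hF).1 hA
      exact h.leafSet_nonempty hF x
    · intro i hi
      have hi' := (mem_erase.1 hi).1
      exact (h.mem_nodeFamily_leafSet hF).2
        ⟨Sum.inl i, fun he => hi' (Sum.inl_injective he), h.leafSet_inl hF hi'⟩
    · intro A hA B hB
      obtain ⟨x, hx, rfl⟩ := (h.mem_nodeFamily_leafSet hF).1 hA
      obtain ⟨y, hy, rfl⟩ := (h.mem_nodeFamily_leafSet hF).1 hB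
      by_cases hxy : IsAncestor P x y
      · exact Or.inr (Or.inl (leafSet_subset _ _ hxy))
      by_cases hyx : IsAncestor P y x
      · exact Or.inl (leafSet_subset _ _ hyx)
      exact Or.inr (Or.inr (leafSet_disjoint hxy hyx))

/-- The children of a vertex correspond to the children in the hierarchy of leaf sets. -/
lemma mem_childrenOf_leafSet (h : IsRootedTree G (Sum.inl r) P lev) (hF : IsFeynmanTree G)
    {x y : L ⊕ M} (hx : x ≠ Sum.inl r) (hy : y ≠ Sum.inl r) :
    leafSet P y ∈ childrenOf (nodeFamily r fun v : M => leafSet P (Sum.inr v)) (leafSet P x) ↔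
      P y = x := by
  rw [mem_childrenOf]
  constructor
  · rintro ⟨-, hs, hmax⟩
    obtain ⟨ha, hne⟩ := (h.leafSet_ssubset_iff hF hx hy).1 hs
    by_contra hP
    have hPr : P y ≠ Sum.inl r := fun he =>
      hx (h.eq_root_of_isAncestor (he ▸ ha.of_ne hne))
    exact hmax _ ((h.mem_nodeFamily_leafSet hF).2 ⟨P y, hPr, rfl⟩)
      (h.leafSet_ssubset hF hPr (.parent_self y) fun he => h.parent_ne hy he.symm)
      (h.leafSet_ssubset hF hx (ha.of_ne hne) hP)
  · rintro rfl
    refine ⟨(h.mem_nodeFamily_leafSet hF).2 ⟨y, hy, rfl⟩,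
      h.leafSet_ssubset hF hx (.parent_self y) (h.parent_ne hy).symm, ?_⟩
    intro C hC hyC hCx
    obtain ⟨z, hz, rfl⟩ := (h.mem_nodeFamily_leafSet hF).1 hC
    obtain ⟨h1, h2⟩ := (h.leafSet_ssubset_iff hF hz hy).1 hyC
    exact hCx.2 (leafSet_subset _ _ (h1.of_ne h2))

/-- A Feynman tree is determined by the leaf sets of its vertices. -/
lemma eq_of_leafSet_eq {G' : SimpleGraph (L ⊕ M)} {P' : L ⊕ M → L ⊕ M} {lev' : L ⊕ M → ℕ}
    (h : IsRootedTree G (Sum.inl r) P lev) (hF : IsFeynmanTree G)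
    (h' : IsRootedTree G' (Sum.inl r) P' lev') (hF' : IsFeynmanTree G')
    (he : (fun v : M => leafSet P (Sum.inr v)) = fun v => leafSet P' (Sum.inr v)) : G = G' := by
  have hset : ∀ x, x ≠ Sum.inl r → leafSet P x = leafSet P' x := fun x hx => by
    rw [← h.nodeSet_leafSet hF hx, ← h'.nodeSet_leafSet hF' hx, he]
  have hP : ∀ x, x ≠ Sum.inl r → P x = P' x := by
    intro x hx
    by_cases hPx : P x = Sum.inl r
    · rw [hPx, (h'.leafSet_eq_erase_iff hF' hx).1
        ((hset x hx).symm.trans ((h.leafSet_eq_erase_iff hF hx).2 hPx))]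
    · have := (h.mem_childrenOf_leafSet hF hPx hx).2 rfl
      rw [he, hset x hx, hset _ hPx] at this
      exact ((h'.mem_childrenOf_leafSet hF' hPx hx).1 this).symm
  ext x y
  rw [h.adj_iff, h'.adj_iff]
  refine or_congr (and_congr_right fun hx => ?_) (and_congr_right fun hy => ?_)
  · rw [hP x hx]
  · rw [hP y hy]

end IsRootedTree

end

/-! ### From hierarchies back to Feynman trees. -/

section

variable {L M : Type*} [Fintype L] [Fintype M] [DecidableEq L] [DecidableEq M]
  {r : L} {D : M → Finset L}

namespace IsHierarchyLabelling

lemma mem_nodeFamily {A : Finset L} :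
    A ∈ nodeFamily r D ↔ ∃ x, x ≠ Sum.inl r ∧ nodeSet D x = A := by
  simp [nodeFamily]

lemma nodeSet_mem {x : L ⊕ M} (hx : x ≠ Sum.inl r) : nodeSet D x ∈ nodeFamily r D :=
  mem_nodeFamily.2 ⟨x, hx, rfl⟩

lemma nodeSet_injective (hD : IsHierarchyLabelling r D) : Function.Injective (nodeSet D) := by
  have hcard : ∀ i v, ({i} : Finset L) ≠ D v := fun i v he => by
    have := hD.two_le v
    rw [← he] at this
    simp at this
  rintro (i | v) (j | w) he
  · exact congrArg _ (singleton_injective he)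
  · exact absurd he (hcard i w)
  · exact absurd he.symm (hcard j v)
  · exact congrArg _ (hD.injective he)

lemma subset_or_subset (hD : IsHierarchyLabelling r D) {A B C : Finset L}
    (hA : A ∈ nodeFamily r D) (hB : B ∈ nodeFamily r D) (hC : C ∈ nodeFamily r D)
    (hCA : C ⊆ A) (hCB : C ⊆ B) : A ⊆ B ∨ B ⊆ A := by
  rcases hD.isHierarchy.laminar A hA B hB with h | h | h
  · exact Or.inl h
  · exact Or.inr h
  · obtain ⟨i, hi⟩ := hD.isHierarchy.nonempty C hC
    exact absurd (hCB hi) (disjoint_left.1 h (hCA hi))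

lemma eq_of_mem_childrenOf (hD : IsHierarchyLabelling r D) {A B C : Finset L}
    (hA : A ∈ nodeFamily r D) (hB : B ∈ nodeFamily r D)
    (hCA : C ∈ childrenOf (nodeFamily r D) A) (hCB : C ∈ childrenOf (nodeFamily r D) B) :
    A = B := by
  rw [mem_childrenOf] at hCA hCB
  by_contra hne
  rcases hD.subset_or_subset hA hB hCA.1 hCA.2.1.1 hCB.2.1.1 with h | h
  · exact hCB.2.2 A hA hCA.2.1 (h.ssubset_of_ne hne)
  · exact hCA.2.2 B hB hCB.2.1 (h.ssubset_of_ne fun he => hne he.symm)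

lemma exists_parent (hD : IsHierarchyLabelling r D) {x : L ⊕ M} (hx : x ≠ Sum.inl r)
    (hxS : nodeSet D x ≠ univ.erase r) :
    ∃ y, y ≠ Sum.inl r ∧ nodeSet D x ∈ childrenOf (nodeFamily r D) (nodeSet D y) := by
  have hss : nodeSet D x ⊂ univ.erase r :=
    (hD.isHierarchy.subset _ (nodeSet_mem hx)).ssubset_of_ne hxS
  obtain ⟨C, -, hC⟩ := ((nodeFamily r D).filter (nodeSet D x ⊂ ·)).exists_le_minimal
    (mem_filter.2 ⟨hD.isHierarchy.top_mem, hss⟩)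
  obtain ⟨hCF, hxC⟩ := mem_filter.1 hC.prop
  obtain ⟨y, hy, rfl⟩ := mem_nodeFamily.1 hCF
  refine ⟨y, hy, mem_childrenOf.2 ⟨nodeSet_mem hx, hxC, fun E hE hxE hEy => ?_⟩⟩
  exact hEy.2 (hC.2 (mem_filter.2 ⟨hE, hxE⟩) hEy.1)

/-- A parent map that realizes the children relation of the hierarchy. -/
lemma exists_parentMap (hD : IsHierarchyLabelling r D) :
    ∃ P : L ⊕ M → L ⊕ M, P (Sum.inl r) = Sum.inl r ∧
      (∀ x, x ≠ Sum.inl r → (P x = Sum.inl r ↔ nodeSet D x = univ.erase r)) ∧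
      ∀ x y, x ≠ Sum.inl r → y ≠ Sum.inl r →
        (P x = y ↔ nodeSet D x ∈ childrenOf (nodeFamily r D) (nodeSet D y)) := by
  choose! Q hQ hQc using fun x (hx : x ≠ Sum.inl r ∧ nodeSet D x ≠ univ.erase r) =>
    hD.exists_parent hx.1 hx.2
  refine ⟨fun x => if x ≠ Sum.inl r ∧ nodeSet D x ≠ univ.erase r then Q x else Sum.inl r,
    by simp, ?_, ?_⟩
  · intro x hx
    by_cases hxS : nodeSet D x = univ.erase r
    · simp [hxS]
    · simp [hxS, hx, hQ x ⟨hx, hxS⟩]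
  · intro x y hx hy
    by_cases hxS : nodeSet D x = univ.erase r
    · simp only [hxS, ne_eq, not_true_eq_false, and_false, if_false]
      refine iff_of_false (fun h => hy h.symm) fun h => ?_
      exact (mem_childrenOf.1 h).2.1.2 (hD.isHierarchy.subset _ (nodeSet_mem hy))
    · beta_reduce
      rw [if_pos ⟨hx, hxS⟩]
      constructor
      · rintro rfl
        exact hQc x ⟨hx, hxS⟩
      · intro h
        exact hD.nodeSet_injective (hD.eq_of_mem_childrenOf (nodeSet_mem (hQ x ⟨hx, hxS⟩))
          (nodeSet_mem hy) (hQc x ⟨hx, hxS⟩) h)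

/-- Every labelling of a hierarchy comes from a Feynman tree. -/
lemma exists_isFeynmanTree (hD : IsHierarchyLabelling r D) :
    ∃ (G : SimpleGraph (L ⊕ M)) (P : L ⊕ M → L ⊕ M) (lev : L ⊕ M → ℕ),
      IsRootedTree G (Sum.inl r) P lev ∧ IsFeynmanTree G ∧
        (fun v => leafSet P (Sum.inr v)) = D := by
  obtain ⟨P, hPr, hPtop, hP⟩ := hD.exists_parentMap
  have hss : ∀ x, x ≠ Sum.inl r → P x ≠ Sum.inl r → nodeSet D x ⊂ nodeSet D (P x) :=
    fun x hx hPx => (mem_childrenOf.1 ((hP x (P x) hx hPx).1 rfl)).2.1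
  have hmin : ∀ x, x ≠ Sum.inl r → P x ≠ Sum.inl r → ∀ A ∈ nodeFamily r D,
      nodeSet D x ⊂ A → nodeSet D (P x) ⊆ A := by
    intro x hx hPx A hA hxA
    rcases hD.subset_or_subset hA (nodeSet_mem hPx) (nodeSet_mem hx) hxA.1 (hss x hx hPx).1
      with h | h
    · by_contra hn
      exact (mem_childrenOf.1 ((hP x (P x) hx hPx).1 rfl)).2.2 A hA hxA
        (h.ssubset_of_ne fun he => hn he.ge)
    · exact h
  -- The members containing a given node set form a chain, so their number is the depth: the top
  -- member has level 1, below the root at level 0.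
  let lev : L ⊕ M → ℕ := fun x =>
    if x = Sum.inl r then 0 else #((nodeFamily r D).filter (nodeSet D x ⊆ ·))
  have hlev : ∀ x, x ≠ Sum.inl r → lev x = lev (P x) + 1 := by
    intro x hx
    simp only [lev, if_neg hx]
    by_cases hPx : P x = Sum.inl r
    · rw [if_pos hPx, (hPtop x hx).1 hPx, zero_add, card_eq_one]
      refine ⟨univ.erase r, eq_singleton_iff_unique_mem.2
        ⟨mem_filter.2 ⟨hD.isHierarchy.top_mem, Subset.rfl⟩, fun A hA => ?_⟩⟩
      obtain ⟨hA, hSA⟩ := mem_filter.1 hA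
      exact (hD.isHierarchy.subset A hA).antisymm hSA
    · rw [if_neg hPx, ← card_insert_of_notMem (a := nodeSet D x)
        (fun h => (hss x hx hPx).2 (mem_filter.1 h).2)]
      congr 1
      ext A
      simp only [mem_filter, mem_insert]
      constructor
      · rintro ⟨hA, hxA⟩
        by_cases he : A = nodeSet D x
        · exact Or.inl he
        · exact Or.inr ⟨hA, hmin x hx hPx A hA (hxA.ssubset_of_ne fun h => he h.symm)⟩
      · rintro (rfl | ⟨hA, hxA⟩)
        · exact ⟨nodeSet_mem hx, Subset.rfl⟩
        · exact ⟨hA, (hss x hx hPx).1.trans hxA⟩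
  let G : SimpleGraph (L ⊕ M) :=
    { Adj := fun x y => (x ≠ Sum.inl r ∧ y = P x) ∨ (y ≠ Sum.inl r ∧ x = P y)
      symm := ⟨fun _ _ h => Or.symm h⟩
      loopless := ⟨fun x h => by
        obtain ⟨hx, he⟩ : x ≠ Sum.inl r ∧ x = P x := or_self_iff.1 h
        have := hlev x hx
        rw [← he] at this
        omega⟩ }
  have hG : IsRootedTree G (Sum.inl r) P lev := ⟨hPr, hlev, fun _ _ => Iff.rfl⟩
  have hanc : ∀ x, x ≠ Sum.inl r → ∀ y, y ≠ Sum.inl r →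
      (IsAncestor P x y ↔ nodeSet D y ⊆ nodeSet D x) := by
    intro x hx
    refine hG.root_induction (fun h => absurd rfl h) fun y hy ih _ => ?_
    by_cases hyx : y = x
    · subst hyx
      exact iff_of_true (.refl _) Subset.rfl
    by_cases hPy : P y = Sum.inl r
    · refine iff_of_false (fun ha => hx ?_) fun hs => ?_
      · exact hG.eq_root_of_isAncestor (hPy ▸ ha.of_ne hyx)
      · rw [(hPtop y hy).1 hPy] at hs
        exact hyx (hD.nodeSet_injective (((hPtop y hy).1 hPy).trans
          (hs.antisymm (hD.isHierarchy.subset _ (nodeSet_mem hx)))))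
    · constructor
      · exact fun ha => (hss y hy hPy).1.trans ((ih hPy).1 (ha.of_ne hyx))
      · intro hs
        exact ((ih hPy).2 (hmin y hy hPy _ (nodeSet_mem hx)
          (hs.ssubset_of_ne fun he => hyx (hD.nodeSet_injective he)))).parent
  refine ⟨G, P, lev, hG, ⟨hG.isTree, ?_, ?_⟩, ?_⟩
  · intro i
    rw [Set.ncard_eq_one]
    by_cases hi : i = r
    · subst hi
      obtain ⟨t, ht, htS⟩ := mem_nodeFamily.1 hD.isHierarchy.top_mem
      refine ⟨t, Set.ext fun y => ?_⟩
      rw [SimpleGraph.mem_neighborSet, hG.adj_iff, Set.mem_singleton_iff]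
      constructor
      · rintro (⟨h, -⟩ | ⟨hy, he⟩)
        · exact absurd rfl h
        · exact hD.nodeSet_injective (((hPtop y hy).1 he.symm).trans htS.symm)
      · rintro rfl
        exact Or.inr ⟨ht, ((hPtop y ht).2 htS).symm⟩
    · have hi' : (Sum.inl i : L ⊕ M) ≠ Sum.inl r := fun h => hi (Sum.inl_injective h)
      refine ⟨P (Sum.inl i), Set.ext fun y => ?_⟩
      rw [SimpleGraph.mem_neighborSet, hG.adj_iff, Set.mem_singleton_iff]
      constructor
      · rintro (⟨-, h⟩ | ⟨hy, he⟩)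
        · exact h
        · have h1 := hss y hy (he ▸ hi')
          rw [← he] at h1
          exact absurd (ssubset_singleton_iff.1 h1)
            (hD.isHierarchy.nonempty _ (nodeSet_mem hy)).ne_empty
      · exact fun h => Or.inl ⟨hi', h⟩
  · intro v
    have hv : (Sum.inr v : L ⊕ M) ≠ Sum.inl r := Sum.inr_ne_inl
    have hpart := hD.isHierarchy.isSetPartition_childrenOf (nodeSet_mem hv) (hD.two_le v)
    have hchild : ∀ B ∈ childrenOf (nodeFamily r D) (nodeSet D (Sum.inr v)),
        ∃ y, y ≠ Sum.inl r ∧ nodeSet D y = B ∧ P y = Sum.inr v := by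
      intro B hB
      obtain ⟨y, hy, rfl⟩ := mem_nodeFamily.1 (mem_childrenOf.1 hB).1
      exact ⟨y, hy, rfl, (hP y _ hy hv).2 hB⟩
    -- A child block through `i` is a proper subset, so some `j` escapes it and lies in a second
    -- child block. With the parent this gives three neighbours.
    obtain ⟨i, hi⟩ := hD.isHierarchy.nonempty _ (nodeSet_mem hv)
    obtain ⟨B, hB, hiB⟩ := hpart.cover i hi
    obtain ⟨j, hj, hjB⟩ := exists_of_ssubset (mem_childrenOf.1 hB).2.1
    obtain ⟨C, hC, hjC⟩ := hpart.cover j hj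
    obtain ⟨b, hb, rfl, hPb⟩ := hchild B hB
    obtain ⟨c, hc, rfl, hPc⟩ := hchild C hC
    have hne : ∀ b, b ≠ Sum.inl r → P b = Sum.inr v → P (Sum.inr v) ≠ b := by
      rintro b hb hPb rfl
      have h1 := hlev _ hv
      have h2 := hlev _ hb
      rw [hPb] at h2
      omega
    refine (Set.two_lt_ncard_iff (Set.toFinite _)).2 ⟨P (Sum.inr v), b, c,
      hG.adj_parent hv, ?_, ?_, hne b hb hPb, hne c hc hPc, ?_⟩
    · exact hPb ▸ (hG.adj_parent hb).symm
    · exact hPc ▸ (hG.adj_parent hc).symm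
    · rintro rfl
      exact hjB hjC
  · funext v
    ext i
    rw [mem_leafSet]
    by_cases hi : i = r
    · subst hi
      refine iff_of_false (fun ha => ?_) fun hi => ?_
      · exact Sum.inr_ne_inl (hG.eq_root_of_isAncestor ha)
      · exact notMem_erase _ _
          (hD.isHierarchy.subset _ (nodeSet_mem (x := Sum.inr v) Sum.inr_ne_inl) hi)
    · rw [hanc _ Sum.inr_ne_inl _ fun h => hi (Sum.inl_injective h)]
      exact singleton_subset_iff

end IsHierarchyLabelling

end

/-! ### Feynman rules in terms of hierarchies. -/

/-- The offshell variable of the total momentum of a set of external edges. -/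
noncomputable def setOffshell {d : ℕ} {L : Type*} (X : ℝ → ℂ) (k : L → Momentum d)
    (A : Finset L) : ℂ := offshellVar X (∑ i ∈ A, k i)

/-- Here `r` is the edge of the vertex that leads to the root. Momentum conservation lets `X` be
evaluated on sets of child edges only, and disjointness of the blocks turns the momentum of such a
set into a sum over the union of its blocks. -/
lemma vertexFunction_eq_vertexWeight {d : ℕ} {L ι : Type*} [DecidableEq L] [Fintype ι]
    [DecidableEq ι] (a : ℕ → ℂ) (X : ℝ → ℂ) (k : L → Momentum d) (q : ι → Momentum d) (r : ι)
    (φ : ι → Finset L) {A : Finset L} {π : Finset (Finset L)} (hπ : IsSetPartition A π)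
    (hinj : Set.InjOn φ (univ.erase r : Finset ι)) (himg : (univ.erase r).image φ = π)
    (hq : ∀ i, i ≠ r → q i = ∑ j ∈ φ i, k j) (hqr : q r = -∑ j ∈ A, k j) :
    vertexFunction a X q = vertexWeight (symWeight a) (setOffshell X k) π := by
  have hsum : ∀ s ⊆ univ.erase r, ∑ i ∈ s, q i = ∑ j ∈ (s.image φ).biUnion id, k j := by
    intro s hs
    have hsub : s.image φ ⊆ π := himg ▸ image_subset_image hs
    rw [sum_biUnion (t := id) fun B hB C hC hne => hπ.disjoint B (hsub hB) C (hsub hC) hne,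
      sum_image fun i hi j hj he => hinj (hs hi) (hs hj) he]
    exact sum_congr rfl fun i hi => hq i (mem_erase.1 (hs hi)).1
  have hcons : ∑ i, q i = 0 := by
    rw [← add_sum_erase _ _ (mem_univ r), hsum _ Subset.rfl, himg, hπ.biUnion_eq, hqr]
    exact neg_add_cancel _
  have hcard : ∀ s ⊆ univ.erase r, #(s.image φ) = #s := fun s hs =>
    card_image_of_injOn (hinj.mono (coe_subset.2 hs))
  have hcardι : Fintype.card ι = #π + 1 := by
    rw [← himg, hcard _ Subset.rfl, card_erase_add_one (mem_univ r), card_univ]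
  rw [vertexFunction_eq_sum_powerset a X q r hcons, vertexWeight]
  refine sum_bij (fun s _ => s.image φ) ?_ ?_ ?_ ?_
  · intro s hs
    exact mem_powerset.2 (himg ▸ image_subset_image (mem_powerset.1 hs))
  · intro s hs t ht he
    have hs := mem_powerset.1 hs
    have ht := mem_powerset.1 ht
    ext i
    constructor
    · intro hi
      obtain ⟨j, hj, hji⟩ := mem_image.1 (he ▸ mem_image_of_mem φ hi)
      exact hinj (ht hj) (hs hi) hji ▸ hj
    · intro hi
      obtain ⟨j, hj, hji⟩ := mem_image.1 (he ▸ mem_image_of_mem φ hi)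
      exact hinj (hs hj) (ht hi) hji ▸ hj
  · intro Q hQ
    obtain ⟨s, hs, rfl⟩ := subset_image_iff.1 (himg.symm ▸ mem_powerset.1 hQ)
    exact ⟨s, mem_powerset.2 (coe_subset.1 hs), rfl⟩
  · intro s hs
    rw [hcard s (mem_powerset.1 hs), hcardι, setOffshell, hsum s (mem_powerset.1 hs)]

section

variable {d : ℕ} {L M : Type*} [Fintype L] [Fintype M]
  {G : SimpleGraph (L ⊕ M)} {r : L} {P : L ⊕ M → L ⊕ M} {lev : L ⊕ M → ℕ} {k : L → Momentum d}

namespace IsRootedTree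

lemma edgeMomentum_child (h : IsRootedTree G (Sum.inl r) P lev) (k : L → Momentum d)
    {x : L ⊕ M} (hx : x ≠ Sum.inl r) : edgeMomentum G k (P x) x = ∑ i ∈ leafSet P x, k i := by
  classical
  rw [edgeMomentum]
  refine sum_congr ?_ fun _ _ => rfl
  ext i
  simp only [mem_filter, mem_univ, true_and, Sym2.eq_swap (a := P x),
    h.reachable_deleteEdges_iff hx, mem_leafSet]

lemma edgeMomentum_parent (h : IsRootedTree G (Sum.inl r) P lev) (hk : ∑ i, k i = 0)
    {x : L ⊕ M} (hx : x ≠ Sum.inl r) : edgeMomentum G k x (P x) = -∑ i ∈ leafSet P x, k i := by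
  classical
  have hc : edgeMomentum G k x (P x) = ∑ i ∈ (leafSet P x)ᶜ, k i := by
    rw [edgeMomentum]
    refine sum_congr ?_ fun _ _ => rfl
    ext i
    simp only [mem_filter, mem_univ, true_and, h.reachable_parent_deleteEdges_iff hx, mem_compl,
      mem_leafSet]
  rw [hc]
  exact eq_neg_of_add_eq_zero_left ((sum_compl_add_sum _ k).trans hk)

variable [DecidableEq L] [DecidableEq M]

lemma vertexFunction_eq (h : IsRootedTree G (Sum.inl r) P lev) (hF : IsFeynmanTree G)
    (a : ℕ → ℂ) (X : ℝ → ℂ) (hk : ∑ i, k i = 0) (v : M)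
    {_ : Fintype (G.neighborSet (Sum.inr v))} {_ : DecidableEq (G.neighborSet (Sum.inr v))} :
    vertexFunction a X
        (fun u : G.neighborSet (Sum.inr v) => edgeMomentum G k (Sum.inr v) u) =
      vertexWeight (symWeight a) (setOffshell X k)
        (childrenOf (nodeFamily r fun v : M => leafSet P (Sum.inr v)) (leafSet P (Sum.inr v))) := by
  have hv : (Sum.inr v : L ⊕ M) ≠ Sum.inl r := Sum.inr_ne_inl
  have hlab := h.isHierarchyLabelling hF
  have hchild : ∀ u : G.neighborSet (Sum.inr v), u ≠ ⟨P (Sum.inr v), h.adj_parent hv⟩ →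
      u.1 ≠ Sum.inl r ∧ P u.1 = Sum.inr v := by
    rintro ⟨u, hu⟩ hne
    rcases (h.adj_iff _ _).1 hu with ⟨-, rfl⟩ | ⟨h1, h2⟩
    · exact absurd rfl hne
    · exact ⟨h1, h2.symm⟩
  refine vertexFunction_eq_vertexWeight a X k _ ⟨P (Sum.inr v), h.adj_parent hv⟩
    (fun u => leafSet P u.1) (hlab.isHierarchy.isSetPartition_childrenOf
      ((h.mem_nodeFamily_leafSet hF).2 ⟨_, hv, rfl⟩) (hlab.two_le v)) ?_ ?_ ?_ ?_
  · intro u hu w hw he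
    exact Subtype.ext (h.leafSet_injOn hF (hchild u (mem_erase.1 hu).1).1
      (hchild w (mem_erase.1 hw).1).1 he)
  · ext A
    rw [mem_image]
    constructor
    · rintro ⟨u, hu, rfl⟩
      obtain ⟨h1, h2⟩ := hchild u (mem_erase.1 hu).1
      exact (h.mem_childrenOf_leafSet hF hv h1).2 h2
    · intro hA
      obtain ⟨y, hy, rfl⟩ := (h.mem_nodeFamily_leafSet hF).1 (mem_childrenOf.1 hA).1
      have hPy := (h.mem_childrenOf_leafSet hF hv hy).1 hA
      refine ⟨⟨y, hPy ▸ (h.adj_parent hy).symm⟩, mem_erase.2 ⟨fun he => ?_, mem_univ _⟩, rfl⟩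
      have h0 : y = P (Sum.inr v) := congrArg Subtype.val he
      have h1 := h.lev_parent _ hv
      have h2 := h.lev_parent _ hy
      rw [hPy] at h2
      rw [← h0] at h1
      omega
  · intro u hu
    obtain ⟨h1, h2⟩ := hchild u hu
    have := h.edgeMomentum_child k h1
    rwa [h2] at this
  · exact h.edgeMomentum_parent hk hv

end IsRootedTree

end

section

variable {d m : ℕ} {L : Type*} [Fintype L] [DecidableEq L]
  {G : SimpleGraph (L ⊕ Fin m)} {r : L} {P : L ⊕ Fin m → L ⊕ Fin m} {lev : L ⊕ Fin m → ℕ}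
  {k : L → Momentum d}

/-- The propagator above a node, with no propagator at the external edge `r`. -/
noncomputable def nodePropagator (X : ℝ → ℂ) (k : L → Momentum d) (r : L) (A : Finset L) : ℂ :=
  if A = univ.erase r then 1 else Complex.I / setOffshell X k A

namespace IsRootedTree

-- Each internal edge is the upper edge of exactly one vertex, so the product over edges becomes one
-- over vertices. The vertex attached to the root contributes `1`.
open Classical in
lemma prod_propagator_eq (h : IsRootedTree G (Sum.inl r) P lev) (hF : IsFeynmanTree G)
    (X : ℝ → ℂ) (hk : ∑ i, k i = 0) :
    ∏ e : Fin m × Fin m with e.1 < e.2 ∧ G.Adj (Sum.inr e.1) (Sum.inr e.2),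
      propagator X (edgeMomentum G k (Sum.inr e.1) (Sum.inr e.2)) =
    ∏ v : Fin m, nodePropagator X k r (leafSet P (Sum.inr v)) := by
  have hv : ∀ v : Fin m, (Sum.inr v : L ⊕ Fin m) ≠ Sum.inl r := fun v => Sum.inr_ne_inl
  have hpar : ∀ v : Fin m, P (Sum.inr v) ≠ Sum.inl r → ∃ u : Fin m, P (Sum.inr v) = Sum.inr u := by
    intro v hP
    rcases he : P (Sum.inr v) with i | u
    · exact absurd he (h.parent_ne_leaf hF (fun hi => hP (hi ▸ he)) (hv v))
    · exact ⟨u, rfl⟩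
  choose! par hpar using hpar
  have hR : ∏ v : Fin m, nodePropagator X k r (leafSet P (Sum.inr v)) =
      ∏ v : Fin m with P (Sum.inr v) ≠ Sum.inl r,
        Complex.I / setOffshell X k (leafSet P (Sum.inr v)) := by
    rw [prod_filter]
    refine prod_congr rfl fun v _ => ?_
    simp only [nodePropagator, h.leafSet_eq_erase_iff hF (hv v), ne_eq, ite_not]
  have hlev : ∀ v, P (Sum.inr v) ≠ Sum.inl r → lev (Sum.inr v) = lev (Sum.inr (par v)) + 1 := by
    intro v hP
    rw [← hpar v hP]
    exact h.lev_parent _ (hv v)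
  have hadj : ∀ v, P (Sum.inr v) ≠ Sum.inl r → G.Adj (Sum.inr v) (Sum.inr (par v)) := by
    intro v hP
    rw [← hpar v hP]
    exact h.adj_parent (hv v)
  have hne : ∀ v, P (Sum.inr v) ≠ Sum.inl r → v ≠ par v := fun v hP he =>
    (hadj v hP).ne (congrArg _ he)
  rw [hR]
  symm
  refine prod_bij (fun v _ => if v < par v then (v, par v) else (par v, v)) ?_ ?_ ?_ ?_
  · intro v hvm
    have hP := (mem_filter.1 hvm).2
    refine mem_filter.2 ⟨mem_univ _, ?_⟩
    split_ifs with hlt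
    · exact ⟨hlt, hadj v hP⟩
    · exact ⟨lt_of_le_of_ne (not_lt.1 hlt) (hne v hP).symm, (hadj v hP).symm⟩
  · intro v hvm w hwm he
    have h1 := hlev v (mem_filter.1 hvm).2
    have h2 := hlev w (mem_filter.1 hwm).2
    -- Edges are ordered by vertex label, not by depth. If two vertices gave the same edge in
    -- opposite orientations, each would be the parent of the other, against the levels.
    have hcross : v = par w → par v = w → v = w := by
      intro e1 e2
      rw [e2] at h1
      rw [← e1] at h2
      omega
    split_ifs at he
    · exact (Prod.ext_iff.1 he).1
    · exact hcross (Prod.ext_iff.1 he).1 (Prod.ext_iff.1 he).2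
    · exact hcross (Prod.ext_iff.1 he).2 (Prod.ext_iff.1 he).1
    · exact (Prod.ext_iff.1 he).2
  · rintro ⟨u, w⟩ he
    obtain ⟨-, hlt, hadj'⟩ := mem_filter.1 he
    have key : ∀ u w : Fin m, Sum.inr w = P (Sum.inr u) →
        P (Sum.inr u) ≠ Sum.inl r ∧ par u = w := by
      intro u w hw
      have hP : P (Sum.inr u) ≠ Sum.inl r := hw ▸ hv w
      exact ⟨hP, Sum.inr_injective ((hpar u hP).symm.trans hw.symm)⟩
    rcases (h.adj_iff _ _).1 hadj' with ⟨-, hw⟩ | ⟨-, hu⟩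
    · obtain ⟨hP, rfl⟩ := key u w hw
      exact ⟨u, mem_filter.2 ⟨mem_univ _, hP⟩, if_pos hlt⟩
    · obtain ⟨hP, rfl⟩ := key w u hu
      exact ⟨w, mem_filter.2 ⟨mem_univ _, hP⟩, if_neg hlt.le.not_gt⟩
  · intro v hvm
    have hP := (mem_filter.1 hvm).2
    have e1 := h.edgeMomentum_parent hk (hv v)
    have e2 := h.edgeMomentum_child k (hv v)
    rw [hpar v hP] at e1 e2
    split_ifs
    · rw [propagator, e1, offshellVar_neg, setOffshell]
    · rw [propagator, e2, setOffshell]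

/-- The amplitude of a tree in terms of the hierarchy of its leaf sets. -/
lemma treeAmplitude_eq (h : IsRootedTree G (Sum.inl r) P lev) (hF : IsFeynmanTree G)
    (a : ℕ → ℂ) (X : ℝ → ℂ) (hk : ∑ i, k i = 0) :
    treeAmplitude a X k G =
      ∏ v : Fin m, (Complex.I * nodePropagator X k r (leafSet P (Sum.inr v))) *
        vertexWeight (symWeight a) (setOffshell X k)
          (childrenOf (nodeFamily r fun v : Fin m => leafSet P (Sum.inr v))
            (leafSet P (Sum.inr v))) := by
  classical
  rw [treeAmplitude, h.prod_propagator_eq hF X hk, ← prod_mul_distrib]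
  refine prod_congr rfl fun v _ => ?_
  rw [h.vertexFunction_eq hF a X hk v]
  ring

end IsRootedTree

end

/-- The weight of an inner vertex in the hierarchy of a tree with root `r`. -/
noncomputable def feynmanWeight {d : ℕ} {L : Type*} [Fintype L] [DecidableEq L] (a : ℕ → ℂ)
    (X : ℝ → ℂ) (k : L → Momentum d) (r : L) (A : Finset L) (π : Finset (Finset L)) : ℂ :=
  (Complex.I * nodePropagator X k r A) * vertexWeight (symWeight a) (setOffshell X k) π

/-! ### Counting labellings and summing over trees. -/

section

variable {d m : ℕ} {L : Type*} [Fintype L] [DecidableEq L]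

open Classical in
/-- Trees with labelled vertices correspond to labelled hierarchies. -/
lemma sum_treeAmplitude_eq (a : ℕ → ℂ) (X : ℝ → ℂ) {k : L → Momentum d} (hk : ∑ i, k i = 0)
    (r : L) :
    ∑ G : SimpleGraph (L ⊕ Fin m) with IsFeynmanTree G, treeAmplitude a X k G =
      ∑ D : Fin m → Finset L with IsHierarchyLabelling r D,
        ∏ v, feynmanWeight a X k r (D v) (childrenOf (nodeFamily r D) (D v)) := by
  have : Nonempty (L ⊕ Fin m) := ⟨Sum.inl r⟩
  have hroot : ∀ G : SimpleGraph (L ⊕ Fin m), IsFeynmanTree G →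
      ∃ P lev, IsRootedTree G (Sum.inl r) P lev := fun G hG => hG.1.exists_isRootedTree _
  choose! P lev hP using hroot
  have hmem : ∀ G ∈ (univ.filter fun G : SimpleGraph (L ⊕ Fin m) => IsFeynmanTree G),
      IsFeynmanTree G := fun G hG => (mem_filter.1 hG).2
  refine sum_bij (fun G _ => fun v => leafSet (P G) (Sum.inr v)) ?_ ?_ ?_ ?_
  · intro G hG
    exact mem_filter.2 ⟨mem_univ _, (hP G (hmem G hG)).isHierarchyLabelling (hmem G hG)⟩
  · intro G hG G' hG' he
    exact (hP G (hmem G hG)).eq_of_leafSet_eq (hmem G hG) (hP G' (hmem G' hG')) (hmem G' hG') he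
  · intro D hD
    obtain ⟨G, Q, lev', hQ, hG, rfl⟩ := (mem_filter.1 hD).2.exists_isFeynmanTree
    refine ⟨G, mem_filter.2 ⟨mem_univ _, hG⟩, ?_⟩
    -- The parent map chosen for `G` may differ in origin from `Q`, but graph and root determine it.
    rw [hQ.parent_unique (hP G hG)]
  · intro G hG
    exact (hP G (hmem G hG)).treeAmplitude_eq (hmem G hG) a X hk

lemma mem_nodeFamily_iff {r : L} {D : Fin m → Finset L} {A : Finset L} :
    A ∈ nodeFamily r D ↔ (∃ i, i ≠ r ∧ {i} = A) ∨ ∃ v, D v = A := by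
  simp only [nodeFamily, nodeSet, mem_image, mem_erase, mem_univ, and_true, Sum.exists,
    Sum.elim_inl, Sum.elim_inr, ne_eq, Sum.inl.injEq, reduceCtorEq, not_false_eq_true, true_and]

lemma IsHierarchyLabelling.filter_nodeFamily {r : L} {D : Fin m → Finset L}
    (hD : IsHierarchyLabelling r D) :
    (nodeFamily r D).filter (fun A => 2 ≤ #A) = univ.image D := by
  ext A
  simp only [mem_filter, mem_nodeFamily_iff, mem_image, mem_univ, true_and]
  constructor
  · rintro ⟨⟨i, -, rfl⟩ | h, h2⟩
    · simp at h2
    · exact h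
  · rintro ⟨v, rfl⟩
    exact ⟨Or.inr ⟨v, rfl⟩, hD.two_le v⟩

/-- A hierarchy contains all singletons, so it is recovered from its nontrivial members. By `hm`, an
injection of `Fin m` into these members hits all of them. -/
lemma isHierarchyLabelling_and_nodeFamily_eq_iff {r : L} {F : Finset (Finset L)}
    (hF : IsHierarchy (univ.erase r) F) (hm : #(F.filter fun A => 2 ≤ #A) = m)
    {D : Fin m → Finset L} :
    IsHierarchyLabelling r D ∧ nodeFamily r D = F ↔
      Function.Injective D ∧ ∀ v, D v ∈ F.filter fun A => 2 ≤ #A := by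
  constructor
  · rintro ⟨hD, rfl⟩
    exact ⟨hD.injective, fun v => mem_filter.2 ⟨mem_nodeFamily_iff.2 (Or.inr ⟨v, rfl⟩),
      hD.two_le v⟩⟩
  · rintro ⟨hinj, hmem⟩
    have himg : univ.image D = F.filter fun A => 2 ≤ #A := by
      refine eq_of_subset_of_card_le (fun A hA => ?_) ?_
      · obtain ⟨v, -, rfl⟩ := mem_image.1 hA
        exact hmem v
      · rw [card_image_of_injective _ hinj, card_univ, Fintype.card_fin, hm]
    have hfam : nodeFamily r D = F := by
      ext A
      rw [mem_nodeFamily_iff]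
      constructor
      · rintro (⟨i, hi, rfl⟩ | ⟨v, rfl⟩)
        · exact hF.singleton_mem i (mem_erase.2 ⟨hi, mem_univ i⟩)
        · exact (mem_filter.1 (hmem v)).1
      · intro hA
        rcases Nat.lt_or_ge #A 2 with h | h
        · have := card_pos.2 (hF.nonempty A hA)
          obtain ⟨i, rfl⟩ := card_eq_one.1 (by omega : #A = 1)
          exact Or.inl ⟨i, (mem_erase.1 (hF.subset _ hA (mem_singleton_self i))).1, rfl⟩
        · have : A ∈ univ.image D := himg ▸ mem_filter.2 ⟨hA, h⟩
          obtain ⟨v, -, hv⟩ := mem_image.1 this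
          exact Or.inr ⟨v, hv⟩
    exact ⟨⟨hinj, fun v => (mem_filter.1 (hmem v)).2, hfam ▸ hF⟩, hfam⟩

open Classical in
/-- A hierarchy with `m` nontrivial members has `m!` labellings. -/
lemma card_labellings {r : L} {F : Finset (Finset L)} (hF : IsHierarchy (univ.erase r) F)
    (hm : #(F.filter fun A => 2 ≤ #A) = m) :
    #(univ.filter fun D : Fin m → Finset L => IsHierarchyLabelling r D ∧ nodeFamily r D = F) =
      m.factorial := by
  have hcard : Fintype.card (Fin m ↪ {A // A ∈ F.filter fun A => 2 ≤ #A}) = m.factorial := by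
    rw [Fintype.card_embedding_eq, Fintype.card_coe, Fintype.card_fin, hm, Nat.descFactorial_self]
  rw [← hcard, ← card_univ]
  symm
  refine card_bij (fun e _ => fun v => (e v).1) ?_ ?_ ?_
  · intro e _
    refine mem_filter.2 ⟨mem_univ _, (isHierarchyLabelling_and_nodeFamily_eq_iff hF hm).2
      ⟨Subtype.val_injective.comp e.injective, fun v => (e v).2⟩⟩
  · intro e _ e' _ he
    ext1 v
    exact Subtype.ext (congrFun he v)
  · intro D hD
    obtain ⟨hinj, hmem⟩ := (isHierarchyLabelling_and_nodeFamily_eq_iff hF hm).1 (mem_filter.1 hD).2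
    exact ⟨⟨fun v => ⟨D v, hmem v⟩, fun v w he => hinj (congrArg Subtype.val he)⟩,
      mem_univ _, rfl⟩

/-- A tree with `m` inner vertices has at least `m + 2` external edges. -/
lemma IsFeynmanTree.add_two_le_card {G : SimpleGraph (L ⊕ Fin m)} (hG : IsFeynmanTree G) :
    m + 2 ≤ Fintype.card L := by
  classical
  have hsum := G.sum_degrees_eq_twice_card_edges
  have hedge := hG.1.card_edgeFinset
  have hdeg : ∀ x, G.degree x = (G.neighborSet x).ncard := fun x => by
    rw [← G.card_neighborSet_eq_degree, Set.ncard_eq_toFinset_card', Set.toFinset_card]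
  have hge : ∑ _v : Fin m, 3 ≤ ∑ v : Fin m, G.degree (Sum.inr v) :=
    sum_le_sum fun v _ => (hdeg _).symm ▸ hG.2.2 v
  have hleaf : ∑ i : L, G.degree (Sum.inl i) = Fintype.card L := by
    simp [hdeg, hG.2.1]
  rw [Fintype.sum_sum_type, hleaf] at hsum
  rw [Fintype.card_sum, Fintype.card_fin] at hedge
  rw [sum_const, card_univ, Fintype.card_fin, smul_eq_mul] at hge
  -- The degree sum is `2 (card L + m - 1)` and at least `card L + 3 m`.
  omega

/-- Any labelling of `F` is realised by a tree, where edges can be counted. The bound ensures that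
the range of `m` in `treeSum` misses no hierarchy. -/
lemma IsHierarchy.card_filter_add_two_le {r : L} {F : Finset (Finset L)}
    (hF : IsHierarchy (univ.erase r) F) : #(F.filter fun A => 2 ≤ #A) + 2 ≤ Fintype.card L := by
  classical
  have hpos : 0 < #(univ.filter fun D : Fin #(F.filter fun A => 2 ≤ #A) → Finset L =>
      IsHierarchyLabelling r D ∧ nodeFamily r D = F) := by
    rw [card_labellings hF rfl]
    exact Nat.factorial_pos _
  obtain ⟨D, hD⟩ := card_pos.1 hpos
  obtain ⟨G, -, -, -, hG, -⟩ := (mem_filter.1 hD).2.1.exists_isFeynmanTree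
  exact hG.add_two_le_card

open Classical in
/-- The sum over labelled hierarchies counts every hierarchy `m!` times. -/
lemma sum_labellings_eq (w : Finset L → Finset (Finset L) → ℂ) (r : L) :
    1 / (m.factorial : ℂ) * ∑ D : Fin m → Finset L with IsHierarchyLabelling r D,
        ∏ v, w (D v) (childrenOf (nodeFamily r D) (D v)) =
      ∑ F ∈ hierarchies (univ.erase r) with #(F.filter fun A => 2 ≤ #A) = m,
        ∏ A ∈ F with 2 ≤ #A, w A (childrenOf F A) := by
  have hcard : ∀ D : Fin m → Finset L, IsHierarchyLabelling r D →
      #((nodeFamily r D).filter fun A => 2 ≤ #A) = m := fun D hD => by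
    rw [hD.filter_nodeFamily, card_image_of_injective _ hD.injective, card_univ, Fintype.card_fin]
  rw [← sum_fiberwise_of_maps_to (g := fun D => nodeFamily r D)
    (t := (hierarchies (univ.erase r)).filter fun F => #(F.filter fun A => 2 ≤ #A) = m)
    fun D hD => mem_filter.2 ⟨mem_hierarchies.2 (mem_filter.1 hD).2.isHierarchy,
      hcard D (mem_filter.1 hD).2⟩, mul_sum]
  refine sum_congr rfl fun F hF => ?_
  obtain ⟨hF, hm⟩ := mem_filter.1 hF
  rw [mem_hierarchies] at hF
  have hconst : ∀ D ∈ (univ.filter fun D : Fin m → Finset L => IsHierarchyLabelling r D).filter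
      fun D => nodeFamily r D = F,
      ∏ v, w (D v) (childrenOf (nodeFamily r D) (D v)) =
        ∏ A ∈ F with 2 ≤ #A, w A (childrenOf F A) := by
    intro D hD
    obtain ⟨hDm, hDF⟩ := mem_filter.1 hD
    have hlab := (mem_filter.1 hDm).2
    rw [← hDF, hlab.filter_nodeFamily, prod_image fun v _ w _ h => hlab.injective h]
  rw [sum_congr rfl hconst, sum_const, filter_filter, card_labellings hF hm, nsmul_eq_mul,
    ← mul_assoc, one_div, inv_mul_cancel₀ (Nat.cast_ne_zero.2 m.factorial_ne_zero), one_mul]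

end

/-- The tree sum as a sum over hierarchies on the external edges other than `r`. -/
theorem treeSum_eq_hierarchySum {d n : ℕ} (a : ℕ → ℂ) (X : ℝ → ℂ) {k : Fin n → Momentum d}
    (hk : ∑ i, k i = 0) (r : Fin n) :
    treeSum a X k = hierarchySum (feynmanWeight a X k r) (univ.erase r) := by
  classical
  have hm : ∀ m ∈ range n, 1 / (m.factorial : ℂ) *
      ∑ G : SimpleGraph (Fin n ⊕ Fin m) with IsFeynmanTree G, treeAmplitude a X k G =
      ∑ F ∈ hierarchies (univ.erase r) with #(F.filter fun A => 2 ≤ #A) = m,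
        ∏ A ∈ F with 2 ≤ #A, feynmanWeight a X k r A (childrenOf F A) := fun m _ => by
    rw [← sum_labellings_eq, ← sum_treeAmplitude_eq a X hk r]
  have hmaps : ∀ F ∈ hierarchies (univ.erase r), #(F.filter fun A => 2 ≤ #A) ∈ range n := by
    intro F hF
    have := (mem_hierarchies.1 hF).card_filter_add_two_le
    rw [Fintype.card_fin] at this
    exact mem_range.2 (by omega)
  rw [hierarchySum, ← sum_fiberwise_of_maps_to hmaps, treeSum]
  refine sum_congr rfl fun m hmn => ?_
  rw [← hm m hmn]

/-! ### Evaluation of the tree sum. -/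

/-- The tree sum when all external edges except possibly `r` are onshell. -/
theorem treeSum_eq {d n : ℕ} (hn : 2 < n) {a : ℕ → ℂ} (ha : a 0 = 1) {X : ℝ → ℂ}
    {k : Fin n → Momentum d} (hk : AdmissibleKinematics X k) (r : Fin n)
    (hon : ∀ i, i ≠ r → offshellVar X (k i) = 0) :
    treeSum a X k =
      -Complex.I * inverseCoeff (symWeight a) (univ.erase r) * ∑ i, offshellVar X (k i) := by
  have hcard : #((univ : Finset (Fin n)).erase r) = n - 1 := by
    rw [card_erase_of_mem (mem_univ r), card_univ, Fintype.card_fin]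
  -- The complement of `r` carries momentum `-k r`, and all summands other than `r` vanish.
  have htop : setOffshell X k (univ.erase r) = ∑ i, offshellVar X (k i) := by
    have hsum := add_sum_erase univ k (mem_univ r)
    rw [hk.1] at hsum
    rw [setOffshell, eq_neg_of_add_eq_zero_right hsum, offshellVar_neg,
      sum_eq_single_of_mem r (mem_univ r) fun i _ hi => hon i hi]
  have hprop : ∀ A, A ⊂ univ.erase r → 2 ≤ #A →
      Complex.I * nodePropagator X k r A * setOffshell X k A = -1 := by
    intro A hA h2
    have hne : setOffshell X k A ≠ 0 := by
      refine hk.2 A h2 ?_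
      -- As a proper subset of `univ.erase r`, the set `A` misses `r` and at least one further edge.
      have := card_lt_card hA
      rw [card_compl, Fintype.card_fin]
      omega
    rw [nodePropagator, if_neg hA.ne, mul_assoc, div_mul_cancel₀ _ hne, Complex.I_mul_I]
  rw [treeSum_eq_hierarchySum a X hk.1 r]
  have hmain := hierarchySum_vertexWeight (symWeight_zero a) ((symWeight_one a).trans ha)
    (f := setOffshell X k) (p := fun A => Complex.I * nodePropagator X k r A)
    (S := univ.erase r) (by omega) (fun i hi => by
      rw [setOffshell, sum_singleton]
      exact hon i (mem_erase.1 hi).1) hprop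
  refine hmain.trans ?_
  rw [nodePropagator, if_pos rfl, htop]
  ring

theorem mainTheorem5 :
    -- the tree sums
    (∀ n : ℕ, 2 < n → ∃ C : (ℕ → ℂ) → ℂ,
      ∀ a : ℕ → ℂ, a 0 = 1 →
      ∀ (d : ℕ) (X : ℝ → ℂ) (k : Fin n → Momentum d), AdmissibleKinematics X k →
        -- at most one external edge is offshell
        {i : Fin n | offshellVar X (k i) ≠ 0}.Subsingleton →
        treeSum a X k = -Complex.I * C a * ∑ i, offshellVar X (k i)) ∧
    -- the onshell tree sums vanish and agree with those of the untransformed field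
    (∀ n : ℕ, 2 < n →
      ∀ a : ℕ → ℂ, a 0 = 1 →
      ∀ (d : ℕ) (X : ℝ → ℂ) (k : Fin n → Momentum d), AdmissibleKinematics X k →
        (∀ i, offshellVar X (k i) = 0) →
        treeSum a X k = 0 ∧ treeSum a X k = treeSum trivialDiffeo X k) ∧
    -- the quadratic part of the Lagrangian, hence the propagator, is not changed
    (∀ a : ℕ → ℂ, a 0 = 1 →
      ∀ (d : ℕ) (X : ℝ → ℂ) (p : Momentum d),
        vertexFunction a X ![p, -p] = offshellVar X p) := by
  refine ⟨fun n hn => ?_, fun n hn a ha d X k hk hon => ?_, fun a ha d X p =>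
    vertexFunction_pair a ha X p⟩
  · have hn0 : 0 < n := by omega
    -- For `a 0 = 1` this is `(n - 1)!` times the coefficient of degree `n - 1` of the inverse
    -- diffeomorphism; the omitted edge is arbitrary.
    refine ⟨fun a => inverseCoeff (symWeight a) (univ.erase (⟨0, hn0⟩ : Fin n)), ?_⟩
    intro a ha d X k hk hsub
    obtain ⟨r, hr⟩ : ∃ r, ∀ i, i ≠ r → offshellVar X (k i) = 0 := by
      by_cases h : ∃ r, offshellVar X (k r) ≠ 0
      · obtain ⟨r, hr⟩ := h
        exact ⟨r, fun i hi => by_contra fun hne => hi (hsub hne hr)⟩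
      · exact ⟨⟨0, hn0⟩, fun i _ => by_contra fun hne => h ⟨i, hne⟩⟩
    rw [treeSum_eq hn ha hk r hr, inverseCoeff_eq_of_card (S := univ.erase r)
      (T := univ.erase (⟨0, hn0⟩ : Fin n)) _ (by simp [card_erase_of_mem])]
  · have hzero : ∀ b : ℕ → ℂ, b 0 = 1 → treeSum b X k = 0 := fun b hb => by
      rw [treeSum_eq hn hb hk ⟨0, by omega⟩ fun i _ => hon i, sum_eq_zero fun i _ => hon i,
        mul_zero]
    exact ⟨hzero a ha, (hzero a ha).trans (hzero trivialDiffeo (by simp [trivialDiffeo])).symm⟩
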